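/- A family of sets $K_1,\dots,K_k\subset\mathbb R^2$ covers $X\subset\mathbb R^2$ if $\bigcup_{i=1}^k K_i=X$. A finite set $P\subset\mathbb R^2$ is in general position if no three distinct points of $P$ are collinear. For such $P$, let $\mathrm{cov}(P)$ be the minimal number of convex sets that cover $\mathbb R^2\setminus P$, and for an integer $n\ge 0$ let $\mathrm{cov}(n)=\max \mathrm{cov}(P)$, the maximum being over all sets $P\subset\mathbb R^2$ of $n$ points in general position. Theorem. For every $n\ge 0$, the complement $\mathbb R^2\setminus P$ of any set $P$ of $n$ points in general position in the plane can be covered by at most $\frac{7n}{11}+4$ convex sets; that is, $$\mathrm{cov}(n)\le \frac{7n}{11}+4 .$$ -/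

import Mathlib

open scoped ENNReal

/-- The Euclidean plane. -/
abbrev Plane : Type := EuclideanSpace ℝ (Fin 2)

/-- A set of points is in general position if no three distinct points of it are collinear. -/
def InGeneralPosition (P : Set Plane) : Prop :=
  ∀ a ∈ P, ∀ b ∈ P, ∀ c ∈ P, a ≠ b → b ≠ c → a ≠ c → ¬ Collinear ℝ ({a, b, c} : Set Plane)

/-- `X` is covered by `k` convex sets: `X` is exactly the union of `k` convex sets. -/
def CoveredByConvex (k : ℕ) (X : Set Plane) : Prop :=
  ∃ K : Fin k → Set Plane, (∀ i, Convex ℝ (K i)) ∧ (⋃ i, K i) = X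

/-- The least number of convex sets that cover `X`; it is `⊤` if no finite number suffices. -/
noncomputable def convexityNumber (X : Set Plane) : ℕ∞ :=
  ⨅ (k : ℕ) (_ : CoveredByConvex k X), (k : ℕ∞)

/-- `cov(n)`: the largest convexity number of the complement of `n` points in general position. -/
noncomputable def covMax (n : ℕ) : ℕ∞ :=
  ⨆ (P : Finset Plane) (_ : P.card = n) (_ : InGeneralPosition (P : Set Plane)),
    convexityNumber (P : Set Plane)ᶜ

/-! Points are deleted in groups, by induction. Deleting three consecutive hull vertices costs two
convex sets, which gives the bound `(2n + 5) / 3`; among at least `17` points some eight can be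
deleted at the cost of five sets, which gives `(5n + 18) / 8 ≤ 7n / 11 + 4`.

Let `ab` be a hull edge and `T` the five points that come first in the angular order around `a`. If
they do not also come first around `b`, then some point of the segment `ab` is collinear with a
point `x` of `T` and a point `y` outside `T`, and the first such line separates `a` from `b` and has
exactly five points, `b` among them, on the side of `b`. These five points together with `a`, `x`
and `y` are deleted: one set lies beyond `ab`, and the side of `b` is split along a line through one
of its four other points, so that the two-thirds bound is applied to only three points.

If this never happens, a point `u` with at most five points to the right of the ray from a hull
vertex to `u` has at most four to the right of the ray from the next hull vertex, and so on around
the hull. Such a `u` is itself a hull vertex: otherwise it is surrounded by three hull vertices, and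
each of the at least `16` other points lies to the right of one of the three rays to `u`, which
accounts for at most `15`. It follows that for consecutive hull vertices `v₀, …, v₇` the line `v₁v₆`
cuts off exactly `v₂, …, v₅`. These eight vertices are deleted at the cost of four outer
half-planes, one for each edge `v₀v₁`, `v₂v₃`, `v₄v₅`, `v₆v₇`, and one set in the cap beyond `v₁v₆`.
-/

/-! ### Covers by convex sets -/

theorem coveredByConvex_iUnion {ι : Type*} [Fintype ι] {K : ι → Set Plane}
    (hK : ∀ i, Convex ℝ (K i)) : CoveredByConvex (Fintype.card ι) (⋃ i, K i) :=
  ⟨fun i => K ((Fintype.equivFin ι).symm i), fun _ => hK _,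
    (Fintype.equivFin ι).symm.surjective.iUnion_comp K⟩

theorem coveredByConvex_of_convex {A : Set Plane} (hA : Convex ℝ A) : CoveredByConvex 1 A :=
  ⟨fun _ => A, fun _ => hA, Set.iUnion_const A⟩

theorem CoveredByConvex.union {k l : ℕ} {X Y : Set Plane} (hX : CoveredByConvex k X)
    (hY : CoveredByConvex l Y) : CoveredByConvex (k + l) (X ∪ Y) := by
  obtain ⟨K, hK, rfl⟩ := hX
  obtain ⟨L, hL, rfl⟩ := hY
  simpa [Set.iUnion_sumElim] using
    coveredByConvex_iUnion (K := Sum.elim K L) (Sum.forall.2 ⟨hK, hL⟩)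

theorem CoveredByConvex.mono {k l : ℕ} {X : Set Plane} (hX : CoveredByConvex k X) (h : k ≤ l) :
    CoveredByConvex l X := by
  obtain ⟨j, rfl⟩ := Nat.exists_eq_add_of_le h
  have hj : CoveredByConvex j (∅ : Set Plane) := ⟨fun _ => ∅, fun _ => convex_empty, by simp⟩
  simpa using hX.union hj

theorem CoveredByConvex.diff {k : ℕ} {P Q A : Set Plane} (hk : CoveredByConvex k Qᶜ)
    (hA : Convex ℝ A) (hQ : Q ⊆ P) (hPA : ∀ z ∈ P, z ∈ A → z ∈ Q) :
    CoveredByConvex k (A \ P) := by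
  obtain ⟨K, hK, hKQ⟩ := hk
  refine ⟨fun i => A ∩ K i, fun i => hA.inter (hK i), ?_⟩
  rw [← Set.inter_iUnion, hKQ]
  ext z
  exact and_congr_right fun hz => not_congr ⟨fun h => hQ h, fun h => hPA z h hz⟩

theorem CoveredByConvex.diff_of_disjoint {k : ℕ} {P A : Set Plane} (hA : CoveredByConvex k A)
    (hPA : ∀ z ∈ P, z ∉ A) : CoveredByConvex k (A \ P) := by
  rwa [(Set.disjoint_left.2 fun z hz hzP => hPA z hzP hz).sdiff_eq_left]

theorem coveredByConvex_diff {P A : Set Plane} (hA : Convex ℝ A) (hPA : ∀ z ∈ P, z ∉ A) :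
    CoveredByConvex 1 (A \ P) :=
  (coveredByConvex_of_convex hA).diff_of_disjoint hPA

theorem CoveredByConvex.union_diff {k l : ℕ} {P A B : Set Plane} (hA : CoveredByConvex k (A \ P))
    (hB : CoveredByConvex l (B \ P)) : CoveredByConvex (k + l) ((A ∪ B) \ P) := by
  rw [Set.union_sdiff_distrib]
  exact hA.union hB

/-- `m` points can be deleted from `P` in such a way that putting them back increases the number of
convex sets needed to cover the complement by at most `j`. -/
def Removable (P : Finset Plane) (m j : ℕ) : Prop :=
  ∃ Q ⊆ P, Q.card + m = P.card ∧
    ∀ k, CoveredByConvex k (Q : Set Plane)ᶜ → CoveredByConvex (k + j) (P : Set Plane)ᶜ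

theorem removable_card_of_cover {P D : Finset Plane} {A B : Set Plane} {j : ℕ} (hD : D ⊆ P)
    (hA : Convex ℝ A) (hDA : ∀ z ∈ D, z ∉ A) (hB : CoveredByConvex j (B \ P))
    (hAB : ∀ z ∉ P, z ∈ A ∨ z ∈ B) : Removable P D.card j := by
  refine ⟨P \ D, Finset.sdiff_subset, Finset.card_sdiff_add_card_eq_card hD, fun k hk => ?_⟩
  have hA' : CoveredByConvex k (A \ P) := hk.diff hA
    (by exact_mod_cast Finset.sdiff_subset) fun z hz hzA => by
      exact_mod_cast Finset.mem_sdiff.2 ⟨hz, fun hzD => hDA z hzD hzA⟩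
  have hcompl : (P : Set Plane)ᶜ = (A ∪ B) \ P := by
    ext z
    exact ⟨fun hz => ⟨hAB z hz, hz⟩, fun hz => hz.2⟩
  rw [hcompl]
  exact hA'.union_diff hB

/-! ### Orientation and sides of a line -/

section PosSide

variable {E : Type*} [AddCommGroup E] [Module ℝ E]

/-- The open half-space `0 < f` together with the part of its boundary on which `g` takes values
in `I`. -/
def posSide (f g : E →ᵃ[ℝ] ℝ) (I : Set ℝ) : Set E := {z | 0 < f z ∨ f z = 0 ∧ g z ∈ I}

theorem convex_posSide (f g : E →ᵃ[ℝ] ℝ) {I : Set ℝ} (hI : Convex ℝ I) :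
    Convex ℝ (posSide f g I) := by
  rw [convex_iff_forall_pos]
  intro x hx y hy s t hs ht hst
  have hcomb (h : E →ᵃ[ℝ] ℝ) : h (s • x + t • y) = s * h x + t * h y := by
    simpa using Convex.combo_affine_apply (f := h) hst
  rw [posSide, Set.mem_ofPred_eq, hcomb, hcomb]
  rcases hx with hx | ⟨hx, hxI⟩ <;> rcases hy with hy | ⟨hy, hyI⟩
  · exact Or.inl (by positivity)
  · exact Or.inl (by rw [hy, mul_zero, add_zero]; positivity)
  · exact Or.inl (by rw [hx, mul_zero, zero_add]; positivity)
  · exact Or.inr ⟨by rw [hx, hy, mul_zero, mul_zero, add_zero], hI hxI hyI hs.le ht.le hst⟩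

end PosSide

/-- The signed area of the parallelogram spanned by `d` and a variable vector. -/
noncomputable def cross (d : Plane) : Plane →ₗ[ℝ] ℝ :=
  d 0 • EuclideanSpace.projₗ 1 - d 1 • EuclideanSpace.projₗ 0

/-- Twice the signed area of the triangle `a b c`, as an affine function of `c`: it is positive when
`c` lies to the left of the line from `a` to `b`. -/
noncomputable def ori (a b : Plane) : Plane →ᵃ[ℝ] ℝ :=
  (cross (b - a)).toAffineMap.comp (AffineMap.id ℝ Plane - AffineMap.const ℝ Plane a)

theorem ori_apply (a b c : Plane) :
    ori a b c = (b 0 - a 0) * (c 1 - a 1) - (b 1 - a 1) * (c 0 - a 0) := by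
  simp [ori, cross]

theorem ori_rotate (a b c : Plane) : ori b c a = ori a b c := by simp only [ori_apply]; ring

theorem ori_swap_right (a b c : Plane) : ori a c b = -ori a b c := by simp only [ori_apply]; ring

theorem ori_swap_left (a b c : Plane) : ori b a c = -ori a b c := by simp only [ori_apply]; ring

theorem ori_self_left (a b : Plane) : ori a b a = 0 := by simp only [ori_apply]; ring

theorem ori_self_right (a b : Plane) : ori a b b = 0 := by simp only [ori_apply]; ring

theorem ori_eq_add (a b c m : Plane) : ori a b c = ori m a b + ori m b c + ori m c a := by
  simp only [ori_apply]
  ring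

/-- The coordinate along the line through `a` and `b` that is `0` at `a` and `1` at `b`, extended to
the plane by orthogonal projection; it vanishes identically when `a = b`. -/
noncomputable def linePos (a b : Plane) : Plane →ᵃ[ℝ] ℝ :=
  ((‖b - a‖ ^ 2)⁻¹ • (innerₛₗ ℝ (b - a))).toAffineMap.comp
    (AffineMap.id ℝ Plane - AffineMap.const ℝ Plane a)

theorem linePos_apply (a b c : Plane) :
    linePos a b c = (‖b - a‖ ^ 2)⁻¹ * inner ℝ (b - a) (c - a) := by
  simp [linePos, inner_sub_left]

theorem linePos_left (a b : Plane) : linePos a b a = 0 := by simp [linePos_apply]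

theorem linePos_right {a b : Plane} (hab : a ≠ b) : linePos a b b = 1 := by
  rw [linePos_apply, real_inner_self_eq_norm_sq,
    inv_mul_cancel₀ (pow_ne_zero 2 (norm_ne_zero_iff.2 (sub_ne_zero.2 hab.symm)))]

theorem eq_of_ori_eq {a b z w : Plane} {f : Plane →ᵃ[ℝ] ℝ} (hf : f a ≠ f b)
    (hori : ori a b z = ori a b w) (hfzw : f z = f w) : z = w := by
  have hd : f.linear (b - a) ≠ 0 := by
    rw [← vsub_eq_sub, f.linearMap_vsub, vsub_eq_sub]
    exact sub_ne_zero.2 hf.symm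
  have hu : f.linear (z - w) = 0 := by
    rw [← vsub_eq_sub, f.linearMap_vsub, vsub_eq_sub, hfzw, sub_self]
  have hcoord (i : Fin 2) : (b - a) i • (z - w) = (z - w) i • (b - a) := by
    simp only [ori_apply] at hori
    ext j
    fin_cases i <;> fin_cases j <;>
      simp only [Fin.zero_eta, Fin.mk_one, PiLp.smul_apply, PiLp.sub_apply, smul_eq_mul] <;>
      linarith
  have hzero (i : Fin 2) : (z - w) i = 0 := by
    have := congrArg f.linear (hcoord i)
    rw [map_smul, map_smul, hu, smul_zero, smul_eq_mul, eq_comm, mul_eq_zero] at this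
    exact this.resolve_right hd
  exact sub_eq_zero.1 (by ext i; exact hzero i)

theorem lineMap_linePos {a b z : Plane} (hab : a ≠ b) (hz : ori a b z = 0) :
    AffineMap.lineMap a b (linePos a b z) = z := by
  have hline := linePos_right hab
  refine eq_of_ori_eq (a := a) (b := b) (f := linePos a b) ?_ ?_ ?_
  · simp [linePos_left, hline]
  · simp [AffineMap.apply_lineMap, ori_self_left, ori_self_right, hz]
  · simp [AffineMap.apply_lineMap, linePos_left, hline, AffineMap.lineMap_apply_ring]

theorem apply_eq_of_ori_eq_zero {a b z : Plane} (hab : a ≠ b) (hz : ori a b z = 0)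
    (f : Plane →ᵃ[ℝ] ℝ) : f z = (1 - linePos a b z) * f a + linePos a b z * f b := by
  conv_lhs => rw [← lineMap_linePos hab hz]
  rw [AffineMap.apply_lineMap, AffineMap.lineMap_apply_ring]

theorem linePos_ne_zero {a b z : Plane} (hab : a ≠ b) (hz : ori a b z = 0) (hza : z ≠ a) :
    linePos a b z ≠ 0 := fun h => hza <| by
  rw [← lineMap_linePos hab hz, h, AffineMap.lineMap_apply_zero]

theorem linePos_ne_one {a b z : Plane} (hab : a ≠ b) (hz : ori a b z = 0) (hzb : z ≠ b) :
    linePos a b z ≠ 1 := fun h => hzb <| by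
  rw [← lineMap_linePos hab hz, h, AffineMap.lineMap_apply_one]

theorem InGeneralPosition.ori_ne_zero {P : Set Plane} (hP : InGeneralPosition P) {a b c : Plane}
    (ha : a ∈ P) (hb : b ∈ P) (hc : c ∈ P) (hab : a ≠ b) (hbc : b ≠ c) (hac : a ≠ c) :
    ori a b c ≠ 0 := fun h => by
  refine hP c hc a ha b hb hac.symm hab hbc.symm (collinear_insert_of_mem_affineSpan_pair ?_)
  rw [← lineMap_linePos hab h]
  exact AffineMap.lineMap_mem_affineSpan_pair _ a b

theorem InGeneralPosition.subset {P Q : Set Plane} (hP : InGeneralPosition P) (h : Q ⊆ P) :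
    InGeneralPosition Q :=
  fun a ha b hb c hc => hP a (h ha) b (h hb) c (h hc)

/-- The open half-plane to the left of the line from `a` to `b`, together with the part of that line
where `linePos a b` lies in `I`. -/
noncomputable def leftSide (a b : Plane) (I : Set ℝ) : Set Plane :=
  posSide (ori a b) (linePos a b) I

/-- The open half-plane to the right of the line from `a` to `b`, together with the part of that
line where `linePos a b` lies in `I`. -/
noncomputable def rightSide (a b : Plane) (I : Set ℝ) : Set Plane :=
  posSide (-ori a b) (linePos a b) I

theorem mem_leftSide {a b z : Plane} {I : Set ℝ} :
    z ∈ leftSide a b I ↔ 0 < ori a b z ∨ ori a b z = 0 ∧ linePos a b z ∈ I :=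
  Iff.rfl

theorem mem_rightSide {a b z : Plane} {I : Set ℝ} :
    z ∈ rightSide a b I ↔ ori a b z < 0 ∨ ori a b z = 0 ∧ linePos a b z ∈ I := by
  simp [rightSide, posSide]

theorem convex_leftSide (a b : Plane) {I : Set ℝ} (hI : Convex ℝ I) : Convex ℝ (leftSide a b I) :=
  convex_posSide _ _ hI

theorem convex_rightSide (a b : Plane) {I : Set ℝ} (hI : Convex ℝ I) :
    Convex ℝ (rightSide a b I) :=
  convex_posSide _ _ hI

theorem rightSide_mono (a b : Plane) {I J : Set ℝ} (hIJ : I ⊆ J) :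
    rightSide a b I ⊆ rightSide a b J := fun _ =>
  Or.imp_right (And.imp_right fun h => hIJ h)

theorem left_notMem_leftSide {a b : Plane} {I : Set ℝ} (hI : 0 ∉ I) : a ∉ leftSide a b I := by
  simpa [mem_leftSide, ori_self_left, linePos_left]

theorem right_notMem_leftSide {a b : Plane} {I : Set ℝ} (hab : a ≠ b) (hI : 1 ∉ I) :
    b ∉ leftSide a b I := by
  simpa [mem_leftSide, ori_self_right, linePos_right hab]

theorem left_notMem_rightSide {a b : Plane} {I : Set ℝ} (hI : 0 ∉ I) : a ∉ rightSide a b I := by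
  simpa [mem_rightSide, ori_self_left, linePos_left]

theorem right_notMem_rightSide {a b : Plane} {I : Set ℝ} (hab : a ≠ b) (hI : 1 ∉ I) :
    b ∉ rightSide a b I := by
  simpa [mem_rightSide, ori_self_right, linePos_right hab]

theorem notMem_leftSide_of_ori_neg {a b z : Plane} {I : Set ℝ} (hz : ori a b z < 0) :
    z ∉ leftSide a b I := by
  rw [mem_leftSide]
  rintro (h | h) <;> linarith

theorem notMem_rightSide_of_ori_pos {a b z : Plane} {I : Set ℝ} (hz : 0 < ori a b z) :
    z ∉ rightSide a b I := by
  rw [mem_rightSide]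
  rintro (h | h) <;> linarith

theorem mem_leftSide_or_mem_rightSide {a b z : Plane} {I J : Set ℝ}
    (h : ori a b z = 0 → linePos a b z ∈ I ∨ linePos a b z ∈ J) :
    z ∈ leftSide a b I ∨ z ∈ rightSide a b J := by
  rw [mem_leftSide, mem_rightSide]
  rcases lt_trichotomy (ori a b z) 0 with h0 | h0 | h0
  · exact Or.inr (Or.inl h0)
  · exact (h h0).imp (fun hI => Or.inr ⟨h0, hI⟩) fun hJ => Or.inr ⟨h0, hJ⟩
  · exact Or.inl (Or.inl h0)

/-! ### Hull edges -/

/-- For points `q` strictly to the left of the line from `b` to `c`, the cotangent of the angle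
`c b q`, up to a positive factor; it decreases as `q` turns counterclockwise around `b`. -/
noncomputable def cotAngle (b c q : Plane) : ℝ := linePos b c q / ori b c q

theorem cotAngle_le_cotAngle_iff {b c p q : Plane} (hp : 0 < ori b c p) (hq : 0 < ori b c q) :
    cotAngle b c q ≤ cotAngle b c p ↔ 0 ≤ ori b p q := by
  have hbc : b ≠ c := by
    rintro rfl
    simp [ori_apply] at hp
  have hlen : 0 < ‖c - b‖ ^ 2 := pow_pos (norm_pos_iff.2 (sub_ne_zero.2 hbc.symm)) 2
  have hid : linePos b c p * ori b c q - linePos b c q * ori b c p = ori b p q := by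
    rw [linePos_apply, linePos_apply, mul_assoc, mul_assoc, ← mul_sub,
      inv_mul_eq_iff_eq_mul₀ hlen.ne', EuclideanSpace.real_norm_sq_eq]
    simp only [ori_apply, PiLp.inner_apply, Fin.sum_univ_two, PiLp.sub_apply,
      RCLike.inner_apply, conj_trivial]
    ring
  rw [cotAngle, cotAngle, div_le_div_iff₀ hq hp, ← sub_nonneg, hid]

theorem exists_angular_first {P : Set Plane} (hP : InGeneralPosition P) {b c : Plane}
    {S : Finset Plane} (hb : b ∈ P) (hSP : (S : Set Plane) ⊆ P) (hne : S.Nonempty)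
    (hS : ∀ q ∈ S, 0 < ori b c q) : ∃ x ∈ S, ∀ q ∈ S, q ≠ x → 0 < ori b x q := by
  have hbS : ∀ q ∈ S, b ≠ q := by
    rintro _ hq rfl
    simpa [ori_self_left] using hS _ hq
  obtain ⟨x, hx, hmax⟩ := S.exists_max_image (cotAngle b c) hne
  refine ⟨x, hx, fun q hq hqx => lt_of_le_of_ne ?_ ?_⟩
  · exact (cotAngle_le_cotAngle_iff (hS x hx) (hS q hq)).1 (hmax q hq)
  · exact (hP.ori_ne_zero hb (hSP hx) (hSP hq) (hbS x hx) hqx.symm (hbS q hq)).symm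

theorem exists_supporting_line {P : Finset Plane} (hne : P.Nonempty) :
    ∃ p ∈ P, ∃ c, c ≠ p ∧ ∀ z ∈ P, z ≠ p → 0 < ori p c z := by
  obtain ⟨o, ho⟩ := Infinite.exists_notMem_finset P
  -- A point of `P` farthest from `o` lies on a circle around `o` that encloses `P`; the supporting
  -- line is the tangent there.
  obtain ⟨p, hp, hmax⟩ := P.exists_max_image (fun z => ‖z - o‖ ^ 2) hne
  have hop : p ≠ o := fun h => ho (h ▸ hp)
  refine ⟨p, hp, !₂[p 0 - (p 1 - o 1), p 1 + (p 0 - o 0)], fun hc => hop ?_, fun z hz hzp => ?_⟩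
  · have h0 := congrArg (· 0) hc
    have h1 := congrArg (· 1) hc
    simp only [Matrix.cons_val_zero, Matrix.cons_val_one] at h0 h1
    ext i
    fin_cases i <;> simp only [Fin.zero_eta, Fin.mk_one] <;> linarith
  · have hzo := hmax z hz
    have hpz : 0 < ‖z - p‖ ^ 2 := pow_pos (norm_pos_iff.2 (sub_ne_zero.2 hzp)) 2
    simp only [EuclideanSpace.real_norm_sq_eq, Fin.sum_univ_two, PiLp.sub_apply] at hzo hpz
    simp only [ori_apply, Matrix.cons_val_zero, Matrix.cons_val_one]
    nlinarith

/-- `a → b` is a counterclockwise edge of the convex hull of `P`, where `P` is in general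
position. -/
structure IsHullEdge (P : Finset Plane) (a b : Plane) : Prop where
  left_mem : a ∈ P
  right_mem : b ∈ P
  ne : a ≠ b
  ori_pos : ∀ z ∈ P, z ≠ a → z ≠ b → 0 < ori a b z

/-- A vertex of the convex hull of `P`: a point where a counterclockwise hull edge starts. -/
def IsHullVertex (P : Finset Plane) (a : Plane) : Prop := ∃ b, IsHullEdge P a b

section Hull

variable {P : Finset Plane} {a b c : Plane}

theorem IsHullEdge.ori_nonneg (h : IsHullEdge P a b) {z : Plane} (hz : z ∈ P) :
    0 ≤ ori a b z := by
  by_cases hza : z = a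
  · rw [hza, ori_self_left]
  by_cases hzb : z = b
  · rw [hzb, ori_self_right]
  exact (h.ori_pos z hz hza hzb).le

theorem IsHullEdge.notMem_rightSide (h : IsHullEdge P a b) {I : Set ℝ} (h0 : 0 ∉ I) (h1 : 1 ∉ I)
    {z : Plane} (hz : z ∈ P) : z ∉ rightSide a b I := by
  by_cases hza : z = a
  · exact hza ▸ left_notMem_rightSide h0
  by_cases hzb : z = b
  · exact hzb.symm ▸ right_notMem_rightSide h.ne h1
  exact notMem_rightSide_of_ori_pos (h.ori_pos z hz hza hzb)

theorem IsHullEdge.coveredByConvex_rightSide (h : IsHullEdge P a b) {I : Set ℝ} (hI : Convex ℝ I)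
    (h0 : 0 ∉ I) (h1 : 1 ∉ I) : CoveredByConvex 1 (rightSide a b I \ P) :=
  coveredByConvex_diff (convex_rightSide a b hI) fun _ hz => h.notMem_rightSide h0 h1 hz

theorem exists_hullEdge (hP : InGeneralPosition (P : Set Plane)) (hc : 2 ≤ P.card) :
    ∃ a b, IsHullEdge P a b := by
  obtain ⟨p, hp, c, -, hpc⟩ := exists_supporting_line (Finset.card_pos.1 (by omega : 0 < P.card))
  have hne : (P.erase p).Nonempty :=
    Finset.card_pos.1 (by rw [Finset.card_erase_of_mem hp]; omega)
  obtain ⟨x, hx, hfirst⟩ := exists_angular_first hP hp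
    (by exact_mod_cast P.erase_subset p) hne fun q hq =>
      hpc q (Finset.mem_of_mem_erase hq) (Finset.ne_of_mem_erase hq)
  exact ⟨p, x, hp, Finset.mem_of_mem_erase hx, (Finset.ne_of_mem_erase hx).symm,
    fun q hq hqp => hfirst q (Finset.mem_erase.2 ⟨hqp, hq⟩)⟩

theorem IsHullEdge.exists_next (h : IsHullEdge P a b) (hP : InGeneralPosition (P : Set Plane))
    (hc : 3 ≤ P.card) : ∃ c, c ≠ a ∧ IsHullEdge P b c := by
  have haP : a ∈ P.erase b := Finset.mem_erase.2 ⟨h.ne, h.left_mem⟩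
  have hne : ((P.erase b).erase a).Nonempty := Finset.card_pos.1 (by
    rw [Finset.card_erase_of_mem haP, Finset.card_erase_of_mem h.right_mem]; omega)
  have hextend (q : Plane) : ori b (b + (b - a)) q = ori a b q := by
    simp only [ori_apply, PiLp.add_apply, PiLp.sub_apply]
    ring
  obtain ⟨c, hcS, hfirst⟩ := exists_angular_first hP h.right_mem (c := b + (b - a))
    (by exact_mod_cast (Finset.erase_subset a _).trans (Finset.erase_subset b P)) hne
    fun q hq => by
      simp only [Finset.mem_erase] at hq
      exact (hextend q).symm ▸ h.ori_pos q hq.2.2 hq.1 hq.2.1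
  simp only [Finset.mem_erase] at hcS hfirst
  refine ⟨c, hcS.1, h.right_mem, hcS.2.2, hcS.2.1.symm, fun q hq hqb hqc => ?_⟩
  by_cases hqa : q = a
  · rw [hqa, ori_rotate]
    exact h.ori_pos c hcS.2.2 hcS.1 hcS.2.1
  · exact hfirst q ⟨hqa, hqb, hq⟩ hqc

theorem removable_one (hne : P.Nonempty) : Removable P 1 1 := by
  obtain ⟨p, hp, c, hcp, hpc⟩ := exists_supporting_line hne
  have hPB : ∀ z ∈ P, z ∉ rightSide p c (Set.Iio 0) := fun z hz => by
    by_cases hzp : z = p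
    · exact hzp ▸ left_notMem_rightSide (by simp)
    · exact notMem_rightSide_of_ori_pos (hpc z hz hzp)
  rw [← Finset.card_singleton p]
  refine removable_card_of_cover (Finset.singleton_subset_iff.2 hp)
    (convex_leftSide p c (convex_Ioi 0)) ?_
    (coveredByConvex_diff (convex_rightSide p c (convex_Iio 0)) hPB) fun z hz => ?_
  · simp only [Finset.mem_singleton, forall_eq]
    exact left_notMem_leftSide (by simp)
  · refine mem_leftSide_or_mem_rightSide fun hline => ?_
    exact (linePos_ne_zero hcp.symm hline fun h => hz (h ▸ hp)).lt_or_gt.symm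

theorem IsHullEdge.removable_three (hab : IsHullEdge P a b) (hbc : IsHullEdge P b c)
    (hca : c ≠ a) : Removable P 3 2 := by
  have hD : ({a, b, c} : Finset Plane) ⊆ P := by
    simp [Finset.insert_subset_iff, hab.left_mem, hbc.left_mem, hbc.right_mem]
  have hA : Convex ℝ (leftSide a b (Set.Iio 0) ∩ leftSide b c (Set.Ioo 0 1)) :=
    (convex_leftSide a b (convex_Iio 0)).inter (convex_leftSide b c (convex_Ioo 0 1))
  have hB : CoveredByConvex 2
      ((rightSide a b (Set.Ioo 0 1) ∪ rightSide b c (Set.Ioi 1)) \ P) :=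
    (hab.coveredByConvex_rightSide (convex_Ioo 0 1) (by simp) (by simp)).union_diff
      (hbc.coveredByConvex_rightSide (convex_Ioi 1) (by simp) (by simp))
  have hc0 : 0 < ori a b c := hab.ori_pos c hbc.right_mem hca hbc.ne.symm
  rw [← Finset.card_eq_three.2 ⟨a, b, c, hab.ne, hca.symm, hbc.ne, rfl⟩]
  refine removable_card_of_cover hD hA ?_ hB fun z hz => ?_
  · simp only [Finset.mem_insert, Finset.mem_singleton, Set.mem_inter_iff]
    rintro z (rfl | rfl | rfl) ⟨hz1, hz2⟩
    · exact left_notMem_leftSide (by simp) hz1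
    · exact right_notMem_leftSide hab.ne (by simp) hz1
    · exact right_notMem_leftSide hbc.ne (by simp) hz2
  · have hza : z ≠ a := fun h => hz (h ▸ hab.left_mem)
    have hzb : z ≠ b := fun h => hz (h ▸ hab.right_mem)
    have hzc : z ≠ c := fun h => hz (h ▸ hbc.right_mem)
    rcases lt_trichotomy (ori a b z) 0 with h1 | h1 | h1
    · exact Or.inr (Or.inl (mem_rightSide.2 (Or.inl h1)))
    · have hline := apply_eq_of_ori_eq_zero hab.ne h1 (ori b c)
      rw [ori_rotate a b c, ori_self_left, mul_zero, add_zero] at hline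
      rcases (linePos_ne_zero hab.ne h1 hza).lt_or_gt with h2 | h2
      · exact Or.inl ⟨Or.inr ⟨h1, h2⟩, Or.inl (by rw [hline]; nlinarith)⟩
      rcases (linePos_ne_one hab.ne h1 hzb).lt_or_gt with h3 | h3
      · exact Or.inr (Or.inl (mem_rightSide.2 (Or.inr ⟨h1, h2, h3⟩)))
      · exact Or.inr (Or.inr (mem_rightSide.2 (Or.inl (by rw [hline]; nlinarith))))
    · have hside : z ∈ leftSide b c (Set.Ioo 0 1) ∨ z ∈ rightSide b c (Set.Ioi 1) := by
        refine mem_leftSide_or_mem_rightSide fun h2 => ?_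
        have hline := apply_eq_of_ori_eq_zero hbc.ne h2 (ori a b)
        rw [ori_self_right, mul_zero, zero_add] at hline
        have hpos : 0 < linePos b c z := pos_of_mul_pos_left (hline ▸ h1) hc0.le
        exact (linePos_ne_one hbc.ne h2 hzc).lt_or_gt.imp_left fun h3 => ⟨hpos, h3⟩
      exact hside.imp (fun h => ⟨Or.inl h1, h⟩) Or.inr

theorem Removable.coveredByConvex_compl {m j k : ℕ} (h : Removable P m j)
    (hP : InGeneralPosition (P : Set Plane))
    (hk : ∀ Q : Finset Plane, Q.card + m = P.card → InGeneralPosition (Q : Set Plane) →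
      CoveredByConvex k (Q : Set Plane)ᶜ) : CoveredByConvex (k + j) (P : Set Plane)ᶜ := by
  obtain ⟨Q, hQP, hcard, hQ⟩ := h
  exact hQ k (hk Q hcard (hP.subset (by exact_mod_cast hQP)))

theorem coveredByConvex_compl_two_thirds (hP : InGeneralPosition (P : Set Plane)) :
    CoveredByConvex ((2 * P.card + 5) / 3) (P : Set Plane)ᶜ := by
  induction hn : P.card using Nat.strong_induction_on generalizing P with
  | _ n ih =>
    obtain rfl | hpos := n.eq_zero_or_pos
    · rw [Finset.card_eq_zero.1 hn, Finset.coe_empty, Set.compl_empty]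
      exact coveredByConvex_of_convex convex_univ
    by_cases h3 : 3 ≤ n
    · obtain ⟨a, b, hab⟩ := exists_hullEdge hP (by omega)
      obtain ⟨c, hca, hbc⟩ := hab.exists_next hP (by omega)
      refine ((hab.removable_three hbc hca).coveredByConvex_compl hP fun Q hc hQ =>
        ih (n - 3) (by omega) hQ (by omega)).mono (by omega)
    · refine ((removable_one (Finset.card_pos.1 (hn ▸ hpos))).coveredByConvex_compl hP
        fun Q hc hQ => ih (n - 1) (by omega) hQ (by omega)).mono (by omega)

/-! ### Cutting along a line through two points -/

theorem mem_ray_split {p q z : Plane} (ha : 0 < ori p q a) (hb : ori p q b < 0) (hza : z ≠ a)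
    (hzb : z ≠ b) (hzp : z ≠ p) (hzq : z ≠ q) :
    z ∈ rightSide a b (Set.Ioo 0 1) ∨
      z ∈ leftSide p q (Set.Ioo 0 1) ∩ leftSide a b (Set.Iio 0) ∨
      z ∈ rightSide p q (Set.Iio 0 ∪ Set.Ioi 1) ∩ leftSide a b (Set.Ioi 1) := by
  have hab : a ≠ b := by
    rintro rfl
    linarith
  have hpq : p ≠ q := by
    rintro rfl
    simp [ori_apply] at ha
  rcases lt_trichotomy (ori a b z) 0 with h | h | h
  · exact Or.inl (mem_rightSide.2 (Or.inl h))
  · have hline := apply_eq_of_ori_eq_zero hab h (ori p q)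
    rcases (linePos_ne_zero hab h hza).lt_or_gt with h0 | h0
    · exact Or.inr (Or.inl ⟨Or.inl (by rw [hline]; nlinarith), Or.inr ⟨h, h0⟩⟩)
    rcases (linePos_ne_one hab h hzb).lt_or_gt with h1 | h1
    · exact Or.inl (mem_rightSide.2 (Or.inr ⟨h, h0, h1⟩))
    · exact Or.inr (Or.inr ⟨mem_rightSide.2 (Or.inl (by rw [hline]; nlinarith)), Or.inr ⟨h, h1⟩⟩)
  · have hside : z ∈ leftSide p q (Set.Ioo 0 1) ∨ z ∈ rightSide p q (Set.Iio 0 ∪ Set.Ioi 1) := by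
      refine mem_leftSide_or_mem_rightSide fun h2 => ?_
      rcases (linePos_ne_zero hpq h2 hzp).lt_or_gt with h0 | h0
      · exact Or.inr (Or.inl h0)
      · exact (linePos_ne_one hpq h2 hzq).lt_or_gt.imp (fun h1 => ⟨h0, h1⟩) Or.inr
    exact Or.inr (hside.imp (fun h2 => ⟨h2, Or.inl h⟩) fun h2 => ⟨h2, Or.inl h⟩)

theorem mem_rightSide_split {p q w z : Plane} (hpq : p ≠ q) (hw : ori p q w < 0) (hzw : z ≠ w)
    (hz : z ∈ rightSide p q (Set.Iio 0 ∪ Set.Ioi 1)) :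
    z ∈ rightSide p q (Set.Iio 0) ∩ rightSide q w (Set.Ioo 0 1) ∨
      z ∈ rightSide p q (Set.Ioi 1) ∩ leftSide q w (Set.Ioi 1) := by
  have hqw : q ≠ w := by
    rintro rfl
    simp [ori_self_right] at hw
  rcases mem_rightSide.1 hz with h | ⟨h, hs⟩
  · have hside : z ∈ leftSide q w (Set.Ioi 1) ∨ z ∈ rightSide q w (Set.Ioo 0 1) := by
      refine mem_leftSide_or_mem_rightSide fun h2 => ?_
      have hline := apply_eq_of_ori_eq_zero hqw h2 (ori p q)
      rw [ori_self_right, mul_zero, zero_add] at hline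
      have hpos : 0 < linePos q w z := pos_of_mul_neg_left (hline ▸ h) hw.le
      exact (linePos_ne_one hqw h2 hzw).lt_or_gt.symm.imp_right fun h1 => ⟨hpos, h1⟩
    exact hside.symm.imp (fun h2 => ⟨mem_rightSide.2 (Or.inl h), h2⟩)
      fun h2 => ⟨mem_rightSide.2 (Or.inl h), h2⟩
  · have hline := apply_eq_of_ori_eq_zero hpq h (ori q w)
    rw [ori_self_left, ori_rotate p q w, mul_zero, add_zero] at hline
    refine hs.imp (fun h0 => ⟨mem_rightSide.2 (Or.inr ⟨h, h0⟩), mem_rightSide.2 (Or.inl ?_)⟩)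
      fun h1 => ⟨mem_rightSide.2 (Or.inr ⟨h, h1⟩), Or.inl ?_⟩
    · rw [hline]
      nlinarith [Set.mem_Iio.1 h0]
    · rw [hline]
      nlinarith [Set.mem_Ioi.1 h1]

theorem coveredByConvex_rightSide_inter {W : Finset Plane} {C : Set Plane} {p q : Plane} {j : ℕ}
    (hP : InGeneralPosition (P : Set Plane)) (hC : Convex ℝ C) (hpq : p ≠ q) (hq : q ∈ P)
    (hWP : W ⊆ P) (hW : W.Nonempty) (hWneg : ∀ w ∈ W, ori p q w < 0)
    (hCpos : ∀ z ∈ P, z ∈ C → z ∉ W → z ≠ p → z ≠ q → 0 < ori p q z)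
    (hcov : ∀ w ∈ W, CoveredByConvex j (W.erase w : Set Plane)ᶜ) :
    CoveredByConvex (1 + j) ((rightSide p q (Set.Iio 0 ∪ Set.Ioi 1) ∩ C) \ P) := by
  obtain ⟨w, hw, hfirst⟩ := exists_angular_first hP hq (by exact_mod_cast hWP) hW
    (c := p) fun z hz => by simpa [ori_swap_left p q] using hWneg z hz
  have hqw : q ≠ w := by
    rintro rfl
    simpa [ori_self_right] using hWneg q hw
  have hsub {I : Set ℝ} (h0 : 0 ∉ I) (h1 : 1 ∉ I) {z : Plane} (hz : z ∈ P)
      (hzpq : z ∈ rightSide p q I) (hzC : z ∈ C) : z ∈ W := by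
    by_contra hzW
    refine notMem_rightSide_of_ori_pos (hCpos z hz hzC hzW ?_ ?_) hzpq <;> rintro rfl
    exacts [left_notMem_rightSide h0 hzpq, right_notMem_rightSide hpq h1 hzpq]
  have hB₁ : CoveredByConvex 1
      ((rightSide p q (Set.Iio 0) ∩ rightSide q w (Set.Ioo 0 1) ∩ C) \ P) := by
    refine coveredByConvex_diff (((convex_rightSide p q (convex_Iio 0)).inter
      (convex_rightSide q w (convex_Ioo 0 1))).inter hC) ?_
    rintro z hz ⟨⟨hz1, hz2⟩, hzC⟩
    by_cases hzw : z = w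
    · exact right_notMem_rightSide hqw (by simp) (hzw ▸ hz2)
    · exact notMem_rightSide_of_ori_pos
        (hfirst z (hsub (by simp) (by simp) hz hz1 hzC) hzw) hz2
  have hB₂ : CoveredByConvex j
      ((rightSide p q (Set.Ioi 1) ∩ leftSide q w (Set.Ioi 1) ∩ C) \ P) := by
    refine (hcov w hw).diff (((convex_rightSide p q (convex_Ioi 1)).inter
      (convex_leftSide q w (convex_Ioi 1))).inter hC)
      (by exact_mod_cast (W.erase_subset w).trans hWP) ?_
    rintro z hz ⟨⟨hz1, hz2⟩, hzC⟩
    refine Finset.mem_coe.2 (Finset.mem_erase.2 ⟨?_, hsub (by simp) (by simp) hz hz1 hzC⟩)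
    rintro rfl
    exact right_notMem_leftSide hqw (by simp) hz2
  convert hB₁.union_diff hB₂ using 1
  ext z
  constructor
  · rintro ⟨⟨hz, hzC⟩, hzP⟩
    exact ⟨(mem_rightSide_split hpq (hWneg w hw) (by rintro rfl; exact hzP (hWP hw)) hz).imp
      (fun h => ⟨h, hzC⟩) fun h => ⟨h, hzC⟩, hzP⟩
  · rintro ⟨⟨⟨hz, -⟩, hzC⟩ | ⟨⟨hz, -⟩, hzC⟩, hzP⟩
    exacts [⟨⟨rightSide_mono p q Set.subset_union_left hz, hzC⟩, hzP⟩,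
      ⟨⟨rightSide_mono p q Set.subset_union_right hz, hzC⟩, hzP⟩]

/-- The points of `P` strictly to the right of the line from `v` to `u`. -/
noncomputable def rightOf (P : Finset Plane) (v u : Plane) : Finset Plane :=
  P.filter fun z => ori v u z < 0

theorem mem_rightOf {v u z : Plane} : z ∈ rightOf P v u ↔ z ∈ P ∧ ori v u z < 0 :=
  Finset.mem_filter

theorem rightOf_subset {v u : Plane} : rightOf P v u ⊆ P :=
  Finset.filter_subset _ _

theorem InGeneralPosition.ori_pos_of_notMem_rightOf (hP : InGeneralPosition (P : Set Plane))
    {p q z : Plane} (hp : p ∈ P) (hq : q ∈ P) (hz : z ∈ P) (hpq : p ≠ q) (hzp : z ≠ p)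
    (hzq : z ≠ q) (h : z ∉ rightOf P p q) : 0 < ori p q z :=
  lt_of_le_of_ne (not_lt.1 fun h0 => h (mem_rightOf.2 ⟨hz, h0⟩))
    (hP.ori_ne_zero hp hq hz hpq hzq.symm hzp.symm).symm

theorem card_insert_rightOf {p q : Plane} (hpq : p ≠ q) (ha : 0 < ori p q a) :
    ({a, p, q} ∪ rightOf P p q : Finset Plane).card = (rightOf P p q).card + 3 := by
  have hnot {u : Plane} (hu : 0 ≤ ori p q u) : u ∉ rightOf P p q := fun h =>
    (mem_rightOf.1 h).2.not_ge hu
  have hap : a ≠ p := by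
    rintro rfl
    simp [ori_self_left] at ha
  have haq : a ≠ q := by
    rintro rfl
    simp [ori_self_right] at ha
  rw [Finset.card_union_of_disjoint, Finset.card_eq_three.2 ⟨a, p, q, hap, haq, hpq, rfl⟩, add_comm]
  simp [Finset.disjoint_left, hnot ha.le, hnot (ori_self_left p q).ge,
    hnot (ori_self_right p q).ge]

theorem IsHullEdge.removable_of_ray {p q : Plane} {m : ℕ}
    (hP : InGeneralPosition (P : Set Plane)) (hab : IsHullEdge P a b) (hp : p ∈ P) (hq : q ∈ P)
    (ha : 0 < ori p q a) (hb : ori p q b < 0) (hcard : (rightOf P p q).card = m + 2) :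
    Removable P (m + 5) ((2 * m + 5) / 3 + 2) := by
  have hbR : b ∈ rightOf P p q := mem_rightOf.2 ⟨hab.right_mem, hb⟩
  have hWcard : ((rightOf P p q).erase b).card = m + 1 := by
    rw [Finset.card_erase_of_mem hbR, hcard]
    rfl
  have hpq : p ≠ q := by
    rintro rfl
    simp [ori_apply] at ha
  have hWP : (rightOf P p q).erase b ⊆ P := (Finset.erase_subset _ _).trans rightOf_subset
  have hcov (w) (hw : w ∈ (rightOf P p q).erase b) :
      CoveredByConvex ((2 * m + 5) / 3) (((rightOf P p q).erase b).erase w : Set Plane)ᶜ := by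
    have h := coveredByConvex_compl_two_thirds
      (hP.subset (by exact_mod_cast (Finset.erase_subset w _).trans hWP))
    rwa [Finset.card_erase_of_mem hw, hWcard] at h
  have hB : CoveredByConvex (1 + (1 + (2 * m + 5) / 3)) ((rightSide a b (Set.Ioo 0 1) ∪
      rightSide p q (Set.Iio 0 ∪ Set.Ioi 1) ∩ leftSide a b (Set.Ioi 1)) \ P) := by
    refine (hab.coveredByConvex_rightSide (convex_Ioo 0 1) (by simp) (by simp)).union_diff
      (coveredByConvex_rightSide_inter hP (convex_leftSide a b (convex_Ioi 1)) hpq hq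
        hWP (Finset.card_pos.1 (by omega))
        (fun z hz => (mem_rightOf.1 (Finset.mem_of_mem_erase hz)).2)
        (fun z hz hzC hzW hzp hzq => hP.ori_pos_of_notMem_rightOf hp hq hz hpq hzp hzq
          fun h => hzW (Finset.mem_erase.2 ⟨?_, h⟩)) hcov)
    rintro rfl
    exact right_notMem_leftSide hab.ne (by simp) hzC
  rw [show m + 5 = (rightOf P p q).card + 3 by omega, ← card_insert_rightOf hpq ha,
    show (2 * m + 5) / 3 + 2 = 1 + (1 + (2 * m + 5) / 3) by ring]
  refine removable_card_of_cover ?_ ((convex_leftSide p q (convex_Ioo 0 1)).inter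
    (convex_leftSide a b (convex_Iio 0))) ?_ hB fun z hz => ?_
  · simp [Finset.insert_subset_iff, hab.left_mem, hp, hq, rightOf_subset]
  · simp only [Finset.mem_union, Finset.mem_insert, Finset.mem_singleton]
    rintro z ((rfl | rfl | rfl) | hz) ⟨hz1, hz2⟩
    · exact left_notMem_leftSide (by simp) hz2
    · exact left_notMem_leftSide (by simp) hz1
    · exact right_notMem_leftSide hpq (by simp) hz1
    · exact notMem_leftSide_of_ori_neg (mem_rightOf.1 hz).2 hz1
  · have hz' {v : Plane} (hv : v ∈ P) : z ≠ v := fun h => hz (h ▸ hv)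
    rcases mem_ray_split ha hb (hz' hab.left_mem) (hz' hab.right_mem) (hz' hp) (hz' hq) with
      h | h | h
    exacts [Or.inr (Or.inl h), Or.inl h, Or.inr (Or.inr h)]

theorem ori_mul_ori_eq (a b x y z : Plane) (t : ℝ) :
    ori a b x * ori x y z = (ori a b y - ori a b x) * ori (AffineMap.lineMap a b t) x z +
      (ori a b x - ori a b z) * ori (AffineMap.lineMap a b t) x y := by
  simp only [ori_apply, AffineMap.lineMap_apply, vsub_eq_sub, vadd_eq_add, PiLp.add_apply,
    PiLp.smul_apply, PiLp.sub_apply, smul_eq_mul]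
  ring

theorem ori_lineMap_left (a b x y : Plane) (t : ℝ) :
    ori (AffineMap.lineMap a b t) x y = (1 - t) * ori a x y + t * ori b x y := by
  rw [← ori_rotate, ← ori_rotate a, ← ori_rotate b, AffineMap.apply_lineMap,
    AffineMap.lineMap_apply_ring]

theorem ori_lineMap_left_pos {a b x : Plane} {t : ℝ} (ht : 0 < t) (hx : 0 < ori a b x) :
    0 < ori (AffineMap.lineMap a b t) x a := by
  rw [ori_lineMap_left, ori_self_left, mul_zero, zero_add, ← ori_rotate b x a, ← ori_rotate x a b]
  exact mul_pos ht hx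

theorem ori_lineMap_right_neg {a b x : Plane} {t : ℝ} (ht : t < 1) (hx : 0 < ori a b x) :
    ori (AffineMap.lineMap a b t) x b < 0 := by
  rw [ori_lineMap_left, ori_self_left, mul_zero, add_zero, ori_swap_right a b x]
  exact mul_neg_of_pos_of_neg (sub_pos.2 ht) (neg_neg_of_pos hx)

theorem exists_first_collinear {a b : Plane} {T U : Finset Plane}
    (ha : ∀ x ∈ T, ∀ y ∈ U, 0 < ori a x y) (hb : ∃ x ∈ T, ∃ y ∈ U, ori b x y < 0) :
    ∃ t ∈ Set.Ioo (0 : ℝ) 1, ∃ x ∈ T, ∃ y ∈ U, ori (AffineMap.lineMap a b t) x y = 0 ∧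
      ∀ u ∈ T, ∀ v ∈ U, 0 ≤ ori (AffineMap.lineMap a b t) u v := by
  -- the parameter at which the moving point becomes collinear with `x` and `y`
  let time (w : Plane × Plane) : ℝ := ori a w.1 w.2 / (ori a w.1 w.2 - ori b w.1 w.2)
  obtain ⟨⟨x, y⟩, hxy, hmin⟩ :=
    ((T ×ˢ U).filter fun w => ori b w.1 w.2 < 0).exists_min_image time (by
      obtain ⟨x, hx, y, hy, h⟩ := hb
      exact ⟨(x, y), by simp [hx, hy, h]⟩)
  simp only [Finset.mem_filter, Finset.mem_product] at hxy hmin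
  obtain ⟨⟨hx, hy⟩, hneg⟩ := hxy
  have hpos := ha x hx y hy
  have hden : 0 < ori a x y - ori b x y := by linarith
  have ht : time (x, y) ∈ Set.Ioo (0 : ℝ) 1 :=
    ⟨div_pos hpos hden, (div_lt_one hden).2 (by linarith)⟩
  refine ⟨time (x, y), ht, x, hx, y, hy, ?_, fun u hu v hv => ?_⟩
  · rw [ori_lineMap_left]
    simp only [time]
    field_simp
    ring
  · rw [ori_lineMap_left]
    have huv := ha u hu v hv
    rcases lt_or_ge (ori b u v) 0 with h | h
    · have hle := (le_div_iff₀ (by linarith)).1 (hmin (u, v) ⟨⟨hu, hv⟩, h⟩)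
      linarith
    · have := mul_nonneg (sub_nonneg.2 ht.2.le) huv.le
      have := mul_nonneg ht.1.le h
      linarith

theorem mem_erase_erase {z : Plane} : z ∈ (P.erase a).erase b ↔ z ∈ P ∧ z ≠ a ∧ z ≠ b := by
  simp only [Finset.mem_erase]
  tauto

theorem IsHullEdge.rightOf_lineMap {T : Finset Plane} {x y : Plane} {t : ℝ}
    (hP : InGeneralPosition (P : Set Plane)) (hab : IsHullEdge P a b) (ht : t ∈ Set.Ioo 0 1)
    (hT : T ⊆ (P.erase a).erase b) (hx : x ∈ T) (hy : y ∈ (P.erase a).erase b \ T)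
    (hxy : ori (AffineMap.lineMap a b t) x y = 0)
    (hnonneg : ∀ u ∈ T, ∀ v ∈ (P.erase a).erase b \ T, 0 ≤ ori (AffineMap.lineMap a b t) u v) :
    rightOf P (AffineMap.lineMap a b t) x = insert b (T.erase x) := by
  set m := AffineMap.lineMap a b t
  obtain ⟨hyR, hyT⟩ := Finset.mem_sdiff.1 hy
  obtain ⟨hyP, hya, hyb⟩ := mem_erase_erase.1 hyR
  obtain ⟨hxP, hxa, hxb⟩ := mem_erase_erase.1 (hT hx)
  have hx0 := hab.ori_pos x hxP hxa hxb
  have hy0 := hab.ori_pos y hyP hya hyb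
  have hmx_neg {z : Plane} (hz : z ∈ T) (hzx : z ≠ x) : ori m x z < 0 := by
    have hzP := (mem_erase_erase.1 (hT hz)).1
    have hratio := ori_mul_ori_eq a b x y z t
    rw [hxy, mul_zero, add_zero] at hratio
    have hy_eq : ori a b y * ori m x z = -(ori a b x * ori m z y) := by
      rw [ori_eq_add x y z m, hxy, ori_swap_right m z y, ori_swap_right m x z] at hratio
      linear_combination -hratio
    refine lt_of_le_of_ne (not_lt.1 fun h => ?_) fun h => ?_
    · linarith [mul_pos hy0 h, mul_nonneg hx0.le (hnonneg z hz y hy)]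
    · rw [h, mul_zero] at hratio
      exact mul_ne_zero hx0.ne' (hP.ori_ne_zero hxP hyP hzP (fun h => hyT (h ▸ hx))
        (fun h => hyT (h ▸ hz)) hzx.symm) hratio
  ext z
  simp only [mem_rightOf, Finset.mem_insert, Finset.mem_erase]
  constructor
  · rintro ⟨hz, hneg⟩
    by_contra! h
    have hzx : z ≠ x := by
      rintro rfl
      exact hneg.ne (ori_self_right m z)
    have hza : z ≠ a := by
      rintro rfl
      exact hneg.not_gt (ori_lineMap_left_pos ht.1 hx0)
    exact hneg.not_ge (hnonneg x hx z
      (Finset.mem_sdiff.2 ⟨mem_erase_erase.2 ⟨hz, hza, h.1⟩, h.2 hzx⟩))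
  · rintro (rfl | ⟨hzx, hz⟩)
    · exact ⟨hab.right_mem, ori_lineMap_right_neg ht.2 hx0⟩
    · exact ⟨(mem_erase_erase.1 (hT hz)).1, hmx_neg hz hzx⟩

theorem IsHullEdge.exists_rightOf_of_swap {T : Finset Plane}
    (hP : InGeneralPosition (P : Set Plane)) (hab : IsHullEdge P a b)
    (hT : T ⊆ (P.erase a).erase b) (ha : ∀ x ∈ T, ∀ y ∈ (P.erase a).erase b \ T, 0 < ori a x y)
    (hb : ∃ x ∈ T, ∃ y ∈ (P.erase a).erase b \ T, ori b x y < 0) :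
    ∃ p ∈ P, ∃ q ∈ P, 0 < ori p q a ∧ ori p q b < 0 ∧ (rightOf P p q).card = T.card := by
  obtain ⟨t, ht, x, hx, y, hy, hxy, hnonneg⟩ := exists_first_collinear ha hb
  have hright := hab.rightOf_lineMap hP ht hT hx hy hxy hnonneg
  obtain ⟨hyR, hyT⟩ := Finset.mem_sdiff.1 hy
  obtain ⟨hyP, hya, -⟩ := mem_erase_erase.1 hyR
  obtain ⟨hxP, hxa, hxb⟩ := mem_erase_erase.1 (hT hx)
  have hx0 := hab.ori_pos x hxP hxa hxb
  set m := AffineMap.lineMap a b t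
  have hratio (z : Plane) : ori a b x * ori x y z = (ori a b y - ori a b x) * ori m x z := by
    rw [ori_mul_ori_eq a b x y z t, hxy, mul_zero, add_zero]
  have hbT : b ∉ T.erase x := fun h => (mem_erase_erase.1 (hT (Finset.mem_of_mem_erase h))).2.2 rfl
  have hcard : (rightOf P m x).card = T.card := by
    rw [hright, Finset.card_insert_of_notMem hbT, Finset.card_erase_add_one hx]
  have hsame {p q : Plane} {c : ℝ} (hc : 0 < c)
      (h : ∀ z, ori a b x * ori p q z = c * ori m x z) :
      0 < ori p q a ∧ ori p q b < 0 ∧ (rightOf P p q).card = T.card := by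
    have hlt (z : Plane) : ori p q z < 0 ↔ ori m x z < 0 := by
      rw [← not_le, ← not_le, ← mul_nonneg_iff_of_pos_left hx0, h, mul_nonneg_iff_of_pos_left hc]
    have hgt : 0 < ori p q a ↔ 0 < ori m x a := by
      rw [← mul_pos_iff_of_pos_left hx0, h, mul_pos_iff_of_pos_left hc]
    refine ⟨hgt.2 (ori_lineMap_left_pos ht.1 hx0), (hlt b).2 (ori_lineMap_right_neg ht.2 hx0), ?_⟩
    rw [← hcard, rightOf, rightOf, Finset.filter_congr fun z _ => hlt z]
  rcases lt_trichotomy (ori a b x) (ori a b y) with hlt | heq | hlt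
  · exact ⟨x, hxP, y, hyP, hsame (sub_pos.2 hlt) hratio⟩
  · have h := hratio a
    rw [← heq, sub_self, zero_mul] at h
    exact absurd h (mul_ne_zero hx0.ne' (hP.ori_ne_zero hxP hyP hab.left_mem
      (fun hxy => hyT (hxy ▸ hx)) hya hxa))
  · refine ⟨y, hyP, x, hxP, hsame (sub_pos.2 hlt) fun z => ?_⟩
    rw [ori_swap_left x y]
    linarith [hratio z]

theorem IsHullEdge.removable_of_swap {T : Finset Plane} {m : ℕ}
    (hP : InGeneralPosition (P : Set Plane)) (hab : IsHullEdge P a b)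
    (hT : T ⊆ (P.erase a).erase b) (hcard : T.card = m + 2)
    (ha : ∀ x ∈ T, ∀ y ∈ (P.erase a).erase b \ T, 0 < ori a x y)
    (hb : ∃ x ∈ T, ∃ y ∈ (P.erase a).erase b \ T, ori b x y < 0) :
    Removable P (m + 5) ((2 * m + 5) / 3 + 2) := by
  obtain ⟨p, hp, q, hq, hpqa, hpqb, hpq⟩ := hab.exists_rightOf_of_swap hP hT ha hb
  exact hab.removable_of_ray hP hp hq hpqa hpqb (hpq.trans hcard)

/-! ### Cutting off a cap -/

theorem exists_lineMap_eq_zero {E : Type*} [AddCommGroup E] [Module ℝ E] {f : E →ᵃ[ℝ] ℝ} {y z : E}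
    (hy : f y < 0) (hz : 0 ≤ f z) : ∃ s ∈ Set.Icc (0 : ℝ) 1, f (AffineMap.lineMap y z s) = 0 := by
  have hden : 0 < f z - f y := by linarith
  refine ⟨-f y / (f z - f y), ⟨div_nonneg (by linarith) hden.le, (div_le_one hden).2 (by linarith)⟩,
    ?_⟩
  rw [AffineMap.apply_lineMap, AffineMap.lineMap_apply_ring']
  field_simp
  ring

theorem ori_neg_of_cap {f f₁ f₂ : Plane →ᵃ[ℝ] ℝ} {y z : Plane} (ha : 0 < f a) (hb : 0 < f b)
    (ha₁ : f₁ a = 0) (hb₁ : 0 < f₁ b) (ha₂ : 0 < f₂ a) (hb₂ : f₂ b = 0) (hy : f y = 0)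
    (hy₁ : 0 ≤ f₁ y) (hy₂ : 0 ≤ f₂ y) (hyab : ori a b y < 0) (hz : f z = 0) (hz₁ : 0 ≤ f₁ z)
    (hz₂ : 0 ≤ f₂ z) : ori a b z < 0 := by
  by_contra! hzab
  obtain ⟨s, hs, hw⟩ := exists_lineMap_eq_zero hyab hzab
  set w := AffineMap.lineMap y z s
  have hab : a ≠ b := by
    rintro rfl
    exact hb₁.ne' ha₁
  have hcomb (g : Plane →ᵃ[ℝ] ℝ) : (1 - s) * g y + s * g z =
      (1 - linePos a b w) * g a + linePos a b w * g b := by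
    rw [← apply_eq_of_ori_eq_zero hab hw, AffineMap.apply_lineMap, AffineMap.lineMap_apply_ring]
  have hs' : 0 ≤ 1 - s := sub_nonneg.2 hs.2
  have hpos₁ : 0 ≤ linePos a b w * f₁ b := by
    have h := hcomb f₁
    rw [ha₁, mul_zero, zero_add] at h
    exact h ▸ add_nonneg (mul_nonneg hs' hy₁) (mul_nonneg hs.1 hz₁)
  have hpos₂ : 0 ≤ (1 - linePos a b w) * f₂ a := by
    have h := hcomb f₂
    rw [hb₂, mul_zero, add_zero] at h
    exact h ▸ add_nonneg (mul_nonneg hs' hy₂) (mul_nonneg hs.1 hz₂)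
  have h₁ := nonneg_of_mul_nonneg_left hpos₁ hb₁
  have h₂ := nonneg_of_mul_nonneg_left hpos₂ ha₂
  have h := hcomb f
  rw [hy, hz, mul_zero, mul_zero, add_zero] at h
  exact ((convex_Ioi (0 : ℝ)) ha hb h₂ h₁ (sub_add_cancel _ _)).ne h

theorem IsHullEdge.ori_pos_of_linePos_mem_Ioo {c d z : Plane} (h : IsHullEdge P c d) (ha : a ∈ P)
    (hb : b ∈ P) (hab : a ≠ b) (hac : a ≠ c) (had : a ≠ d) (hbc : b ≠ c) (hbd : b ≠ d)
    (hz : ori a b z = 0) (hz01 : linePos a b z ∈ Set.Ioo 0 1) : 0 < ori c d z := by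
  rw [apply_eq_of_ori_eq_zero hab hz]
  exact add_pos (mul_pos (sub_pos.2 hz01.2) (h.ori_pos a ha hac had))
    (mul_pos hz01.1 (h.ori_pos b hb hbc hbd))

theorem IsHullEdge.mem_leftSide_or_mem_leftSide {I J : Set ℝ} {z : Plane} (h : IsHullEdge P a b)
    (hIJ : I ∪ J = (Set.Icc 0 1)ᶜ) (hz : z ∉ P) (hzI : z ∉ rightSide a b I) :
    z ∈ leftSide a b (Set.Ioo 0 1) ∨ z ∈ leftSide a b J := by
  rw [mem_rightSide, not_or, not_lt] at hzI
  rcases hzI.1.eq_or_lt with h0 | h0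
  · by_cases hJ : linePos a b z ∈ J
    · exact Or.inr (Or.inr ⟨h0.symm, hJ⟩)
    have hIcc : linePos a b z ∈ Set.Icc 0 1 := by
      rw [← Set.notMem_compl_iff, ← hIJ]
      exact fun hmem => hmem.elim (fun hI => hzI.2 ⟨h0.symm, hI⟩) hJ
    refine Or.inl (Or.inr ⟨h0.symm, hIcc.1.lt_of_ne ?_, hIcc.2.lt_of_ne ?_⟩)
    · exact (linePos_ne_zero h.ne h0.symm fun hza => hz (hza ▸ h.left_mem)).symm
    · exact linePos_ne_one h.ne h0.symm fun hzb => hz (hzb ▸ h.right_mem)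
  · exact Or.inl (Or.inl h0)

theorem mem_edge_regions {ι : Type*} {a b : ι → Plane} {I J : ι → Set ℝ} {C : Set Plane} {z : Plane}
    (hedge : ∀ i, IsHullEdge P (a i) (b i)) (hinj : Function.Injective (Sum.elim a b))
    (hIJ : ∀ i, I i ∪ J i = (Set.Icc 0 1)ᶜ)
    (hJC : ∀ i z, (∀ j, 0 ≤ ori (a j) (b j) z) → ori (a i) (b i) z = 0 →
      linePos (a i) (b i) z ∈ J i → z ∈ C) (hz : z ∉ P) :
    z ∈ ⋂ i, leftSide (a i) (b i) (Set.Ioo 0 1) ∨ (∃ i, z ∈ rightSide (a i) (b i) (I i)) ∨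
      z ∈ C ∩ ⋂ i, leftSide (a i) (b i) (J i) := by
  by_cases hright : ∃ i, z ∈ rightSide (a i) (b i) (I i)
  · exact Or.inr (Or.inl hright)
  simp only [not_exists] at hright
  simp only [Set.mem_inter_iff, Set.mem_iInter]
  by_cases hmid : ∃ i, ori (a i) (b i) z = 0 ∧ linePos (a i) (b i) z ∈ Set.Ioo 0 1
  · obtain ⟨i, hi, hi01⟩ := hmid
    refine Or.inl fun j => ?_
    obtain rfl | hij := eq_or_ne i j
    · exact Or.inr ⟨hi, hi01⟩
    · have hne {s t : ι ⊕ ι} (h : s ≠ t) : Sum.elim a b s ≠ Sum.elim a b t := hinj.ne h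
      exact Or.inl ((hedge j).ori_pos_of_linePos_mem_Ioo (hedge i).left_mem (hedge i).right_mem
        (hedge i).ne (hne (s := .inl i) (t := .inl j) (by simpa))
        (hne (s := .inl i) (t := .inr j) (by simp)) (hne (s := .inr i) (t := .inl j) (by simp))
        (hne (s := .inr i) (t := .inr j) (by simpa)) hi hi01)
  have hleft (i : ι) : z ∈ leftSide (a i) (b i) (J i) :=
    ((hedge i).mem_leftSide_or_mem_leftSide (hIJ i) hz (hright i)).elim
      (Or.imp_right fun h => (hmid ⟨i, h⟩).elim) id
  by_cases hpos : ∀ i, 0 < ori (a i) (b i) z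
  · exact Or.inl fun i => Or.inl (hpos i)
  · obtain ⟨i, hi⟩ := not_forall.1 hpos
    obtain ⟨hi0, hiJ⟩ := (hleft i).resolve_left hi
    exact Or.inr (Or.inr ⟨hJC i z (fun j => (hleft j).elim le_of_lt fun h => h.1.ge) hi0 hiJ,
      hleft⟩)

theorem removable_of_disjoint_edges {ι : Type*} [Fintype ι] {a b : ι → Plane} {I J : ι → Set ℝ}
    {C : Set Plane} (hedge : ∀ i, IsHullEdge P (a i) (b i))
    (hinj : Function.Injective (Sum.elim a b)) (hI : ∀ i, Convex ℝ (I i))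
    (hJ : ∀ i, Convex ℝ (J i)) (hIJ : ∀ i, I i ∪ J i = (Set.Icc 0 1)ᶜ) (hC : Convex ℝ C)
    (hPC : ∀ z ∈ P, z ∈ C → ∃ i, z = a i ∨ z = b i)
    (hJC : ∀ i z, (∀ j, 0 ≤ ori (a j) (b j) z) → ori (a i) (b i) z = 0 →
      linePos (a i) (b i) z ∈ J i → z ∈ C) :
    Removable P (2 * Fintype.card ι) (Fintype.card ι + 1) := by
  have hIJ_ne {i : ι} {t : ℝ} (ht : t ∈ Set.Icc 0 1) : t ∉ I i ∧ t ∉ J i := by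
    rw [← not_or, ← Set.mem_union, hIJ i]
    exact not_not.2 ht
  have hD : (Finset.univ.image (Sum.elim a b)).card = 2 * Fintype.card ι := by
    rw [Finset.card_image_of_injective _ hinj, Finset.card_univ, Fintype.card_sum, two_mul]
  have hright : CoveredByConvex (Fintype.card ι) ((⋃ i, rightSide (a i) (b i) (I i)) \ P) := by
    refine (coveredByConvex_iUnion fun i => convex_rightSide _ _ (hI i)).diff_of_disjoint
      fun z hz => ?_
    simp only [Set.mem_iUnion, not_exists]
    exact fun i => (hedge i).notMem_rightSide (hIJ_ne (by simp)).1 (hIJ_ne (by simp)).1 hz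
  have hcap : CoveredByConvex 1 ((C ∩ ⋂ i, leftSide (a i) (b i) (J i)) \ P) := by
    refine coveredByConvex_diff (hC.inter (convex_iInter fun i => convex_leftSide _ _ (hJ i))) ?_
    rintro z hz ⟨hzC, hzJ⟩
    obtain ⟨i, rfl | rfl⟩ := hPC z hz hzC
    · exact left_notMem_leftSide (hIJ_ne (by simp)).2 (Set.mem_iInter.1 hzJ i)
    · exact right_notMem_leftSide (hedge i).ne (hIJ_ne (by simp)).2 (Set.mem_iInter.1 hzJ i)
  rw [← hD]
  refine removable_card_of_cover ?_
    (convex_iInter fun i => convex_leftSide (a i) (b i) (convex_Ioo 0 1)) ?_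
    (hright.union_diff hcap) fun z hz => ?_
  · simp only [Finset.image_subset_iff, Finset.mem_univ, forall_const, Sum.forall, Sum.elim_inl,
      Sum.elim_inr]
    exact ⟨fun i => (hedge i).left_mem, fun i => (hedge i).right_mem⟩
  · simp only [Finset.mem_image, Finset.mem_univ, true_and, Set.mem_iInter]
    rintro _ ⟨i | i, rfl⟩ h
    · exact left_notMem_leftSide (by simp) (h i)
    · exact right_notMem_leftSide (hedge i).ne (by simp) (h i)
  · rw [Set.mem_union, Set.mem_iUnion]
    exact mem_edge_regions hedge hinj hIJ hJC hz

theorem ori_neg_of_mem_cap_ray {v : ℕ → Plane} {n i : ℕ} {z : Plane} (hn : 0 < n)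
    (hedge : ∀ i ≤ n, IsHullEdge P (v (2 * i)) (v (2 * i + 1)))
    (hinj : Set.InjOn v (Set.Iio (2 * n + 2)))
    (hcap : ∀ i ∈ Set.Ioo 1 (2 * n), ori (v 1) (v (2 * n)) (v i) < 0) (hi : i ≤ n)
    (hz : ∀ j ≤ n, 0 ≤ ori (v (2 * j)) (v (2 * j + 1)) z)
    (hzi : ori (v (2 * i)) (v (2 * i + 1)) z = 0)
    (hpos : linePos (v (2 * i)) (v (2 * i + 1)) z ∈ if i = n then Set.Iio 0 else Set.Ioi (1 : ℝ)) :
    ori (v 1) (v (2 * n)) z < 0 := by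
  have hori {j k : ℕ} (hj : j ≤ n) (hk : k < 2 * n + 2) (hk0 : k ≠ 2 * j) (hk1 : k ≠ 2 * j + 1)
      (hkP : v k ∈ P) : 0 < ori (v (2 * j)) (v (2 * j + 1)) (v k) :=
    (hedge j hj).ori_pos _ hkP (hinj.ne hk (Set.mem_Iio.2 (by omega)) hk0)
      (hinj.ne hk (Set.mem_Iio.2 (by omega)) hk1)
  have hfirst : v 1 ∈ P := (hedge 0 n.zero_le).right_mem
  have hlast : v (2 * n) ∈ P := (hedge n le_rfl).left_mem
  split_ifs at hpos with hin
  · subst hin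
    rw [apply_eq_of_ori_eq_zero (hedge i le_rfl).ne hzi, ori_self_right, mul_zero, zero_add,
      ← ori_rotate]
    exact mul_neg_of_neg_of_pos hpos (hori le_rfl (by omega) (by omega) (by omega) hfirst)
  obtain rfl | hi0 := i.eq_zero_or_pos
  · have hpos₀ := hori hi (k := 2 * n) (by omega) (by omega) (by omega) hlast
    simp only [mul_zero, zero_add, Set.mem_Ioi] at hzi hpos hpos₀
    rw [apply_eq_of_ori_eq_zero (hedge 0 hi).ne hzi, mul_zero, zero_add, ori_self_left, mul_zero,
      add_zero, ori_rotate]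
    exact mul_neg_of_neg_of_pos (sub_neg.2 hpos) hpos₀
  · have hvP : v (2 * i + 1) ∈ P := (hedge i hi).right_mem
    exact ori_neg_of_cap (f := ori (v (2 * i)) (v (2 * i + 1))) (f₁ := ori (v (2 * 0)) (v 1))
      (f₂ := ori (v (2 * n)) (v (2 * n + 1)))
      (hori hi (by omega) (by omega) (by omega) hfirst)
      (hori hi (by omega) (by omega) (by omega) hlast) (ori_self_right _ _)
      (hori n.zero_le (by omega) (by omega) (by omega) hlast)
      (hori le_rfl (by omega) (by omega) (by omega) hfirst) (ori_self_left _ _)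
      (ori_self_right _ _) ((hedge 0 n.zero_le).ori_nonneg hvP) ((hedge n le_rfl).ori_nonneg hvP)
      (hcap _ ⟨by omega, by omega⟩) hzi (hz 0 n.zero_le) (hz n le_rfl)

theorem removable_of_cap {v : ℕ → Plane} {n : ℕ} (hn : 0 < n)
    (hedge : ∀ i ≤ n, IsHullEdge P (v (2 * i)) (v (2 * i + 1)))
    (hinj : Set.InjOn v (Set.Iio (2 * n + 2)))
    (hcap : rightOf P (v 1) (v (2 * n)) = (Finset.Ioo 1 (2 * n)).image v) :
    Removable P (2 * n + 2) (n + 2) := by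
  have hneg (i : ℕ) (hi : i ∈ Set.Ioo 1 (2 * n)) : ori (v 1) (v (2 * n)) (v i) < 0 :=
    (mem_rightOf.1 (hcap ▸ Finset.mem_image_of_mem v (Finset.mem_Ioo.2 hi))).2
  rw [show 2 * n + 2 = 2 * Fintype.card (Fin (n + 1)) by rw [Fintype.card_fin]; ring,
    show n + 2 = Fintype.card (Fin (n + 1)) + 1 by rw [Fintype.card_fin]]
  refine removable_of_disjoint_edges (fun i : Fin (n + 1) => hedge i (by omega))
    (I := fun i => if (i : ℕ) = n then Set.Ioi 1 else Set.Iio 0)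
    (J := fun i => if (i : ℕ) = n then Set.Iio 0 else Set.Ioi 1)
    (C := {z | ori (v 1) (v (2 * n)) z < 0}) ?_ (fun i => ?_) (fun i => ?_) (fun i => ?_)
    ((convex_Iio (0 : ℝ)).affine_preimage (ori (v 1) (v (2 * n)))) (fun z hz hzC => ?_)
    fun i z hz hzi hpos => ?_
  · rintro (i | i) (j | j) h <;> have := hinj (by simp; omega) (by simp; omega) h <;>
      simp <;> omega
  · split_ifs
    exacts [convex_Ioi 1, convex_Iio 0]
  · split_ifs
    exacts [convex_Iio 0, convex_Ioi 1]
  · split_ifs <;> ext t <;> simp [imp_iff_not_or, or_comm]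
  · obtain ⟨j, hj, rfl⟩ := Finset.mem_image.1 (hcap ▸ mem_rightOf.2 ⟨hz, hzC⟩)
    rw [Finset.mem_Ioo] at hj
    obtain ⟨i, rfl | rfl⟩ := j.even_or_odd'
    exacts [⟨⟨i, by omega⟩, Or.inl rfl⟩, ⟨⟨i, by omega⟩, Or.inr rfl⟩]
  · exact ori_neg_of_mem_cap_ray hn hedge hinj hneg (Nat.le_of_lt_succ i.2)
      (fun j hj => hz ⟨j, Nat.lt_succ_of_le hj⟩) hzi hpos

/-! ### Walking around the hull -/

theorem exists_subset_card_eq_forall_le {α β : Type*} [DecidableEq α] [LinearOrder β] (key : α → β)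
    {S : Finset α} {k : ℕ} (hk : k ≤ S.card) :
    ∃ T ⊆ S, T.card = k ∧ ∀ x ∈ T, ∀ y ∈ S \ T, key y ≤ key x := by
  induction k with
  | zero => exact ⟨∅, S.empty_subset, Finset.card_empty, by simp⟩
  | succ k ih =>
    obtain ⟨T, hTS, hT, hle⟩ := ih (by omega)
    obtain ⟨x, hx, hmax⟩ := (S \ T).exists_max_image key
      (Finset.card_pos.1 (by rw [Finset.card_sdiff_of_subset hTS]; omega))
    obtain ⟨hxS, hxT⟩ := Finset.mem_sdiff.1 hx
    refine ⟨insert x T, Finset.insert_subset hxS hTS,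
      by rw [Finset.card_insert_of_notMem hxT, hT], fun u hu y hy => ?_⟩
    rw [Finset.sdiff_insert, Finset.mem_erase] at hy
    obtain rfl | hu := Finset.mem_insert.1 hu
    exacts [hmax y hy.2, hle u hu y hy.2]

theorem IsHullEdge.exists_angular_initial {k : ℕ} (hP : InGeneralPosition (P : Set Plane))
    (hab : IsHullEdge P a b) (hk : k ≤ ((P.erase a).erase b).card) :
    ∃ T ⊆ (P.erase a).erase b, T.card = k ∧
      ∀ x ∈ T, ∀ y ∈ (P.erase a).erase b \ T, 0 < ori a x y := by
  obtain ⟨T, hT, hcard, hle⟩ := exists_subset_card_eq_forall_le (cotAngle a b) hk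
  refine ⟨T, hT, hcard, fun x hx y hy => ?_⟩
  obtain ⟨hyR, hyT⟩ := Finset.mem_sdiff.1 hy
  obtain ⟨hxP, hxa, hxb⟩ := mem_erase_erase.1 (hT hx)
  obtain ⟨hyP, hya, hyb⟩ := mem_erase_erase.1 hyR
  refine lt_of_le_of_ne ?_ (hP.ori_ne_zero hab.left_mem hxP hyP hxa.symm
    (fun hxy => hyT (hxy ▸ hx)) hya.symm).symm
  exact (cotAngle_le_cotAngle_iff (hab.ori_pos x hxP hxa hxb) (hab.ori_pos y hyP hya hyb)).1
    (hle x hx y hy)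

theorem IsHullEdge.mem_of_card_rightOf_le {T : Finset Plane} {u : Plane} (hab : IsHullEdge P a b)
    (hT : T ⊆ (P.erase a).erase b) (hfirst : ∀ x ∈ T, ∀ y ∈ (P.erase a).erase b \ T, 0 < ori a x y)
    (hu : u ∈ (P.erase a).erase b) (h : (rightOf P a u).card ≤ T.card) : u ∈ T := by
  by_contra huT
  obtain ⟨huP, hua, hub⟩ := mem_erase_erase.1 hu
  have hsub : insert b T ⊆ rightOf P a u := by
    refine Finset.insert_subset (mem_rightOf.2 ⟨hab.right_mem, ?_⟩) fun z hz =>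
      mem_rightOf.2 ⟨(mem_erase_erase.1 (hT hz)).1, ?_⟩ <;> rw [ori_swap_right, neg_lt_zero]
    exacts [hab.ori_pos u huP hua hub, hfirst z hz u (Finset.mem_sdiff.2 ⟨hu, huT⟩)]
  have hcard := Finset.card_le_card hsub
  rw [Finset.card_insert_of_notMem fun hb => (mem_erase_erase.1 (hT hb)).2.2 rfl] at hcard
  omega

theorem IsHullEdge.rightOf_subset_erase {T : Finset Plane} {u : Plane} (hab : IsHullEdge P a b)
    (hu : u ∈ P) (hfirst : ∀ y ∈ (P.erase a).erase b \ T, 0 ≤ ori b u y) :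
    rightOf P b u ⊆ T.erase u := fun z hz => by
  obtain ⟨hzP, hneg⟩ := mem_rightOf.1 hz
  have hne {x : Plane} (hx : 0 ≤ ori b u x) : z ≠ x := fun h => hneg.not_ge (h ▸ hx)
  refine Finset.mem_erase.2 ⟨hne (ori_self_right b u).ge, ?_⟩
  by_contra hzT
  exact hneg.not_ge (hfirst z (Finset.mem_sdiff.2 ⟨mem_erase_erase.2
    ⟨hzP, hne (ori_rotate a b u ▸ hab.ori_nonneg hu), hne (ori_self_left b u).ge⟩, hzT⟩))

theorem IsHullEdge.card_rightOf_le {u : Plane} {m : ℕ} (hP : InGeneralPosition (P : Set Plane))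
    (hno : ¬Removable P (m + 5) ((2 * m + 5) / 3 + 2)) (hc : m + 4 ≤ P.card)
    (hab : IsHullEdge P a b) (hu : u ∈ P) (hua : u ≠ a) (hub : u ≠ b)
    (h : (rightOf P a u).card ≤ m + 2) : (rightOf P b u).card ≤ m + 1 := by
  obtain ⟨T, hT, hTcard, hfirst⟩ := hab.exists_angular_initial hP (k := m + 2) (by
    rw [Finset.card_erase_of_mem (Finset.mem_erase.2 ⟨hab.ne.symm, hab.right_mem⟩),
      Finset.card_erase_of_mem hab.left_mem]
    omega)
  have huT : u ∈ T :=
    hab.mem_of_card_rightOf_le hT hfirst (mem_erase_erase.2 ⟨hu, hua, hub⟩) (hTcard ▸ h)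
  have hsub : rightOf P b u ⊆ T.erase u := hab.rightOf_subset_erase hu fun y hy =>
    not_lt.1 fun hneg => hno (hab.removable_of_swap hP hT hTcard hfirst ⟨u, huT, y, hy, hneg⟩)
  have hcard := Finset.card_le_card hsub
  rwa [Finset.card_erase_of_mem huT, hTcard] at hcard

theorem ori_barycentric (x y z u q : Plane) :
    ori x y u * ori u q z + ori y z u * ori u q x + ori z x u * ori u q y = 0 := by
  simp only [ori_apply]
  ring

theorem eq_of_ori_nonneg_of_mem_triangle {x y z u q : Plane} (hxy : 0 < ori x y u)
    (hyz : 0 < ori y z u) (hzx : 0 < ori z x u) (hx : 0 ≤ ori u q x) (hy : 0 ≤ ori u q y)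
    (hz : 0 ≤ ori u q z) : q = u := by
  have hsum := ori_barycentric x y z u q
  have hz' := mul_nonneg hxy.le hz
  have hx' := mul_nonneg hyz.le hx
  have hy' := mul_nonneg hzx.le hy
  have hx₀ : ori u q x = 0 := (mul_eq_zero.1 (by linarith)).resolve_left hyz.ne'
  have hy₀ : ori u q y = 0 := (mul_eq_zero.1 (by linarith)).resolve_left hzx.ne'
  refine eq_of_ori_eq (a := x) (b := u) (f := ori y u) ?_ ?_ ?_
  · rw [ori_rotate, ori_self_right]
    exact hxy.ne'
  · rw [← ori_rotate, hx₀, ori_self_right]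
  · rw [← ori_rotate, hy₀, ori_self_right]

theorem erase_subset_rightOf_of_mem_triangle {x y z u : Plane} (hxy : 0 < ori x y u)
    (hyz : 0 < ori y z u) (hzx : 0 < ori z x u) :
    P.erase u ⊆ rightOf P x u ∪ rightOf P y u ∪ rightOf P z u := by
  intro q hq
  obtain ⟨hqu, hqP⟩ := Finset.mem_erase.1 hq
  by_contra h
  simp only [Finset.mem_union, mem_rightOf, hqP, true_and, not_or, not_lt] at h
  refine hqu (eq_of_ori_nonneg_of_mem_triangle hxy hyz hzx ?_ ?_ ?_) <;> rw [ori_rotate]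
  exacts [h.1.1, h.1.2, h.2]

theorem IsHullVertex.mem (h : IsHullVertex P a) : a ∈ P :=
  h.choose_spec.left_mem

theorem IsHullVertex.notMem_triangle {x y z u : Plane} (hu : IsHullVertex P u) (hx : x ∈ P)
    (hy : y ∈ P) (hz : z ∈ P) (hxy : 0 < ori x y u) (hyz : 0 < ori y z u) : ori z x u ≤ 0 := by
  obtain ⟨q, hq⟩ := hu
  by_contra! hzx
  exact hq.ne (eq_of_ori_nonneg_of_mem_triangle hxy hyz hzx (hq.ori_nonneg hx) (hq.ori_nonneg hy)
    (hq.ori_nonneg hz)).symm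

theorem exists_surrounding_triangle {φ : Plane → Prop} {u v : Plane}
    (hP : InGeneralPosition (P : Set Plane)) (hnext : ∀ x, φ x → ∃ y, φ y ∧ IsHullEdge P x y)
    (hu : u ∈ P) (hφu : ¬φ u) (hφv : φ v) :
    ∃ x y, φ x ∧ φ y ∧ 0 < ori v x u ∧ 0 < ori x y u ∧ 0 < ori y v u := by
  classical
  have hne {x : Plane} (hx : φ x) : u ≠ x := fun h => hφu (h ▸ hx)
  have hedge {x y : Plane} (hx : φ x) (hy : φ y) (hxy : IsHullEdge P x y) : 0 < ori u x y :=
    ori_rotate u x y ▸ hxy.ori_pos u hu (hne hx) (hne hy)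
  obtain ⟨v', hφv', hv'⟩ := hnext v hφv
  -- the last element of the hull, turning around `u` from `v`, before the half-turn
  obtain ⟨x, hx, hlast⟩ := (P.filter fun x => φ x ∧ 0 < ori u v x).exists_min_image
    (cotAngle u v) ⟨v', Finset.mem_filter.2 ⟨hv'.right_mem, hφv', hedge hφv hφv' hv'⟩⟩
  simp only [Finset.mem_filter] at hx hlast
  obtain ⟨-, hφx, hvx⟩ := hx
  obtain ⟨y, hφy, hxy⟩ := hnext x hφx
  have hxy_pos := hedge hφx hφy hxy
  have hvy : ¬0 < ori u v y := fun hvy => by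
    have := (cotAngle_le_cotAngle_iff hvy hvx).1 (hlast y ⟨hxy.right_mem, hφy, hvy⟩)
    rw [ori_swap_right] at this
    linarith
  have hyv : y ≠ v := by
    rintro rfl
    rw [ori_swap_right] at hxy_pos
    linarith
  refine ⟨x, y, hφx, hφy, ori_rotate u v x ▸ hvx, ori_rotate u x y ▸ hxy_pos, ?_⟩
  rw [ori_rotate, ori_swap_right]
  exact neg_pos.2 ((not_lt.1 hvy).lt_of_ne (hP.ori_ne_zero hu hv'.left_mem hxy.right_mem
    (hne hφv) hyv.symm (hne hφy)))

theorem IsHullVertex.of_card_rightOf_le {u v : Plane} {m : ℕ}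
    (hP : InGeneralPosition (P : Set Plane))
    (hno : ¬Removable P (m + 5) ((2 * m + 5) / 3 + 2)) (hc : 3 * m + 8 ≤ P.card)
    (hv : IsHullVertex P v) (hu : u ∈ P) (h : (rightOf P v u).card ≤ m + 2) :
    IsHullVertex P u := by
  by_contra hu'
  have hne {x : Plane} (hx : IsHullVertex P x) : u ≠ x := fun h => hu' (h ▸ hx)
  obtain ⟨x, y, hx, hy, hvx, hxy, hyv⟩ := exists_surrounding_triangle
    (φ := fun x => IsHullVertex P x ∧ (rightOf P x u).card ≤ m + 2) hP (fun x hx => by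
      obtain ⟨⟨y, hxy⟩, hx⟩ := hx
      obtain ⟨z, -, hyz⟩ := hxy.exists_next hP (by omega)
      exact ⟨y, ⟨⟨z, hyz⟩, (hxy.card_rightOf_le hP hno (by omega) hu (hne ⟨y, hxy⟩)
        (hne ⟨z, hyz⟩) hx).trans (Nat.le_succ _)⟩, hxy⟩) hu (fun h => hu' h.1) ⟨hv, h⟩
  have hcard := Finset.card_le_card (erase_subset_rightOf_of_mem_triangle (P := P) hvx hxy hyv)
  rw [Finset.card_erase_of_mem hu] at hcard
  have h₁ := Finset.card_union_le (rightOf P v u ∪ rightOf P x u) (rightOf P y u)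
  have h₂ := Finset.card_union_le (rightOf P v u) (rightOf P x u)
  have := hx.2
  have := hy.2
  omega

theorem IsHullEdge.ori_pos_of_ori_pos {v x y : Plane} (h : IsHullEdge P v b) (hx : x ∈ P)
    (hy : y ∈ P) (hxy : 0 < ori v x y) : 0 < ori v b y := by
  refine h.ori_pos y hy ?_ ?_ <;> rintro rfl
  · exact hxy.ne' (ori_self_left _ _)
  · rw [ori_swap_right] at hxy
    linarith [h.ori_nonneg hx]

theorem IsHullVertex.angular_trans {v x y z : Plane} (hv : IsHullVertex P v) (hx : x ∈ P)
    (hy : y ∈ P) (hz : z ∈ P) (hxy : 0 < ori v x y) (hyz : 0 < ori v y z) : 0 < ori v x z := by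
  obtain ⟨b, hb⟩ := hv
  have hid : ori v b y * ori v x z = ori v b x * ori v y z + ori v b z * ori v x y := by
    simp only [ori_apply]
    ring
  rw [← mul_pos_iff_of_pos_left (hb.ori_pos_of_ori_pos hx hy hxy), hid]
  exact add_pos_of_nonneg_of_pos (mul_nonneg (hb.ori_nonneg hx) hyz.le)
    (mul_pos (hb.ori_pos_of_ori_pos hy hz hyz) hxy)

theorem IsHullVertex.exists_first {S : Finset Plane} {v : Plane} (hv : IsHullVertex P v)
    (hP : InGeneralPosition (P : Set Plane)) (hSP : S ⊆ P) (hvS : v ∉ S) (hne : S.Nonempty) :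
    ∃ x ∈ S, ∀ q ∈ S, q ≠ x → 0 < ori v x q := by
  obtain ⟨b, hb⟩ := hv
  have hpos {q : Plane} (hq : q ∈ S) (hqb : q ≠ b) : 0 < ori v b q :=
    hb.ori_pos q (hSP hq) (ne_of_mem_of_not_mem hq hvS) hqb
  by_cases hbS : b ∈ S
  · exact ⟨b, hbS, fun q hq => hpos hq⟩
  · exact exists_angular_first hP hb.left_mem (by exact_mod_cast hSP) hne
      fun q hq => hpos hq (ne_of_mem_of_not_mem hq hbS)

theorem IsHullEdge.card_le_card_rightOf_add_two (hab : IsHullEdge P a b) :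
    P.card ≤ (rightOf P b a).card + 2 := by
  have hsub : (P.erase a).erase b ⊆ rightOf P b a := fun z hz => by
    obtain ⟨hzP, hza, hzb⟩ := mem_erase_erase.1 hz
    rw [mem_rightOf, ori_swap_left]
    exact ⟨hzP, neg_neg_of_pos (hab.ori_pos z hzP hza hzb)⟩
  have := Finset.card_le_card hsub
  rw [Finset.card_erase_of_mem (Finset.mem_erase.2 ⟨hab.ne.symm, hab.right_mem⟩),
    Finset.card_erase_of_mem hab.left_mem] at this
  omega

theorem insert_rightOf_subset {v w w' : Plane} (hv : IsHullVertex P v) (hw : IsHullEdge P w w')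
    (hpos : 0 < ori v w w') : insert w (rightOf P v w) ⊆ rightOf P v w' := by
  refine Finset.insert_subset (mem_rightOf.2 ⟨hw.left_mem, ?_⟩) fun z hz => ?_
  · rw [ori_swap_right]
    exact neg_neg_of_pos hpos
  · rw [mem_rightOf, ori_swap_right, neg_lt_zero] at hz ⊢
    exact ⟨hz.1, hv.angular_trans hz.1 hw.left_mem hw.right_mem hz.2 hpos⟩

theorem IsHullVertex.rightOf_first_subset {I : Finset Plane} {v w c : Plane}
    (hv : IsHullVertex P v) (hw : w ∈ P) (hc : c ∈ rightOf P v w)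
    (hfirst : ∀ q ∈ rightOf P v w \ I, q ≠ c → 0 < ori v c q) : rightOf P v c ⊆ I := fun z hz => by
  obtain ⟨hcP, hcneg⟩ := mem_rightOf.1 hc
  obtain ⟨hzP, hzneg⟩ := mem_rightOf.1 hz
  have hzc : z ≠ c := by
    rintro rfl
    exact hzneg.ne (ori_self_right _ _)
  by_contra hzI
  refine hzneg.not_gt (hfirst z (Finset.mem_sdiff.2 ⟨mem_rightOf.2 ⟨hzP, ?_⟩, hzI⟩) hzc)
  rw [ori_swap_right, neg_lt_zero] at hzneg hcneg ⊢
  exact hv.angular_trans hzP hcP hw hzneg hcneg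

theorem rightOf_eq_insert {v w w' : Plane} {m : ℕ} (hP : InGeneralPosition (P : Set Plane))
    (hno : ¬Removable P (m + 5) ((2 * m + 5) / 3 + 2)) (hc : 3 * m + 8 ≤ P.card)
    (hv : IsHullVertex P v) (hw : IsHullEdge P w w') (hwv : w ≠ v) (hw'v : w' ≠ v)
    (h : (rightOf P v w).card ≤ m + 1) : rightOf P v w' = insert w (rightOf P v w) := by
  have hvP := hv.mem
  have hww' : 0 < ori v w w' := ori_rotate v w w' ▸ hw.ori_pos v hvP hwv.symm hw'v.symm
  refine (insert_rightOf_subset hv hw hww').antisymm' ?_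
  rw [← Finset.sdiff_eq_empty_iff_subset, ← Finset.not_nonempty_iff_eq_empty]
  intro hne
  -- the first exceptional point would be a hull vertex inside the triangle `v w w'`
  obtain ⟨c, hcS, hfirst⟩ := hv.exists_first hP (Finset.sdiff_subset.trans rightOf_subset)
    (by simp [mem_rightOf, ori_self_left]) hne
  obtain ⟨hcw', hcI⟩ := Finset.mem_sdiff.1 hcS
  obtain ⟨hcP, hcneg⟩ := mem_rightOf.1 hcw'
  rw [Finset.mem_insert, not_or] at hcI
  have hc_ne {u : Plane} (hu : ori v w' u = 0) : c ≠ u := fun hcu => hcneg.ne (hcu ▸ hu)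
  have hcvert : IsHullVertex P c := hv.of_card_rightOf_le hP hno hc hcP
    ((Finset.card_le_card (hv.rightOf_first_subset hw.right_mem hcw' hfirst)).trans
      ((Finset.card_insert_le _ _).trans (Nat.succ_le_succ h)))
  have hvwc : 0 < ori v w c := hP.ori_pos_of_notMem_rightOf hvP hw.left_mem hcP hwv.symm
    (hc_ne (ori_self_left _ _)) hcI.1 hcI.2
  have hww'c : 0 < ori w w' c := hw.ori_pos c hcP hcI.1 (hc_ne (ori_self_right _ _))
  refine (hcvert.notMem_triangle hvP hw.left_mem hw.right_mem hvwc hww'c).not_gt ?_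
  rw [ori_swap_left]
  exact neg_pos.2 hcneg

theorem exists_hull_walk (hP : InGeneralPosition (P : Set Plane)) (hc : 3 ≤ P.card) :
    ∃ v : ℕ → Plane, ∀ i, IsHullEdge P (v i) (v (i + 1)) := by
  obtain ⟨a, b, hab⟩ := exists_hullEdge hP (by omega)
  have hnext (x : {x // IsHullVertex P x}) : ∃ y : {x // IsHullVertex P x}, IsHullEdge P x y := by
    obtain ⟨y, hxy⟩ := x.2
    obtain ⟨z, -, hyz⟩ := hxy.exists_next hP hc
    exact ⟨⟨y, z, hyz⟩, hxy⟩
  choose f hf using hnext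
  let a' : {x // IsHullVertex P x} := ⟨a, b, hab⟩
  refine ⟨fun i => f^[i] a', fun i => ?_⟩
  simpa only [Function.iterate_succ_apply'] using hf (f^[i] a')

theorem rightOf_hull_walk {v : ℕ → Plane} {i m : ℕ} (hP : InGeneralPosition (P : Set Plane))
    (hno : ¬Removable P (m + 5) ((2 * m + 5) / 3 + 2)) (hc : 3 * m + 8 ≤ P.card)
    (hv : ∀ i, IsHullEdge P (v i) (v (i + 1))) (hi : i ≤ m + 2) :
    v (i + 2) ≠ v 1 ∧ rightOf P (v 1) (v (i + 2)) = (Finset.Ioo 1 (i + 2)).image v := by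
  induction i with
  | zero =>
    refine ⟨(hv 1).ne.symm, Finset.filter_eq_empty_iff.2 fun z hz => ?_⟩
    exact ((hv 1).ori_nonneg hz).not_gt
  | succ i ih =>
    obtain ⟨hne, hright⟩ := ih (by omega)
    have hcard : (rightOf P (v 1) (v (i + 2))).card ≤ i := by
      simpa [hright] using Finset.card_image_le (s := Finset.Ioo 1 (i + 2)) (f := v)
    have hne' : v (i + 3) ≠ v 1 := fun h => by
      have := (h ▸ hv (i + 2)).card_le_card_rightOf_add_two
      omega
    refine ⟨hne', ?_⟩
    rw [rightOf_eq_insert hP hno hc ⟨_, hv 1⟩ (hv (i + 2)) hne hne' (by omega), hright,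
      ← Finset.image_insert]
    congr 1
    ext j
    simp only [Finset.mem_insert, Finset.mem_Ioo]
    omega

theorem injOn_hull_walk {v : ℕ → Plane} {m : ℕ} (hP : InGeneralPosition (P : Set Plane))
    (hno : ¬Removable P (m + 5) ((2 * m + 5) / 3 + 2)) (hc : 3 * m + 8 ≤ P.card)
    (hv : ∀ i, IsHullEdge P (v i) (v (i + 1))) : Set.InjOn v (Set.Iio (m + 5)) := by
  have hwalk {j : ℕ} (hj : 2 ≤ j) (hjm : j < m + 5) :
      v j ≠ v 1 ∧ rightOf P (v 1) (v j) = (Finset.Ioo 1 j).image v := by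
    obtain ⟨i, rfl⟩ := Nat.exists_eq_add_of_le' hj
    exact rightOf_hull_walk hP hno hc hv (by omega)
  have hne {i j : ℕ} (hij : i < j) (hj : j < m + 5) : v i ≠ v j := fun h => by
    obtain rfl | rfl | hi : i = 0 ∨ i = 1 ∨ 2 ≤ i := by omega
    · obtain rfl | hj2 : j = 1 ∨ 2 ≤ j := by omega
      · exact (hv 0).ne h
      · have hcard := (hv 0).card_le_card_rightOf_add_two
        have hle := Finset.card_image_le (s := Finset.Ioo 1 j) (f := v)
        rw [h, zero_add, (hwalk hj2 hj).2] at hcard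
        rw [Nat.card_Ioo] at hle
        omega
    · exact (hwalk hij hj).1 h.symm
    · have hmem : v i ∈ rightOf P (v 1) (v j) := by
        rw [(hwalk (by omega) hj).2]
        exact Finset.mem_image_of_mem v (Finset.mem_Ioo.2 ⟨hi, hij⟩)
      exact (mem_rightOf.1 hmem).2.ne (h ▸ ori_self_right _ _)
  intro i hi j hj h
  by_contra hij
  obtain hij | hij := Nat.lt_or_gt_of_ne hij
  exacts [hne hij hj h, hne hij hi h.symm]

theorem removable_eight (hP : InGeneralPosition (P : Set Plane)) (hc : 17 ≤ P.card) :
    Removable P 8 5 := by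
  by_contra hno
  obtain ⟨v, hv⟩ := exists_hull_walk hP (by omega)
  exact hno (removable_of_cap (n := 3) (by omega) (fun i _ => hv (2 * i))
    (injOn_hull_walk (m := 3) hP hno hc hv)
    (rightOf_hull_walk (m := 3) hP hno hc hv (i := 4) (by omega)).2)

theorem coveredByConvex_compl_five_eighths (hP : InGeneralPosition (P : Set Plane)) :
    CoveredByConvex ((5 * P.card + 18) / 8) (P : Set Plane)ᶜ := by
  induction hn : P.card using Nat.strong_induction_on generalizing P with
  | _ n ih =>
    by_cases h17 : 17 ≤ n
    · exact ((removable_eight hP (by omega)).coveredByConvex_compl hP fun Q hc hQ =>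
        ih (n - 8) (by omega) hQ (by omega)).mono (by omega)
    · exact (coveredByConvex_compl_two_thirds hP).mono (by omega)

end Hull

theorem CoveredByConvex.convexityNumber_le {k : ℕ} {X : Set Plane} (h : CoveredByConvex k X) :
    convexityNumber X ≤ k :=
  iInf₂_le k h

theorem five_mul_add_div_eight_le (n : ℕ) :
    (((5 * n + 18) / 8 : ℕ) : ℝ) ≤ 7 * n / 11 + 4 := by
  have hfloor : 8 * ((5 * n + 18) / 8) ≤ 5 * n + 18 := Nat.mul_div_le _ _
  have hfloor' : (8 : ℝ) * ((5 * n + 18) / 8 : ℕ) ≤ 5 * n + 18 := by exact_mod_cast hfloor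
  linarith [(Nat.cast_nonneg n : (0 : ℝ) ≤ n)]

theorem ennreal_five_mul_add_div_eight_le (n : ℕ) :
    (((5 * n + 18) / 8 : ℕ) : ℝ≥0∞) ≤ 7 * n / 11 + 4 := by
  have hnn : (((5 * n + 18) / 8 : ℕ) : NNReal) ≤ 7 * n / 11 + 4 := by
    exact_mod_cast five_mul_add_div_eight_le n
  simpa using ENNReal.coe_le_coe.2 hnn

theorem theorem5_general (n : ℕ) :
    (∀ P : Finset Plane, P.card = n → InGeneralPosition (P : Set Plane) →
      CoveredByConvex ((5 * n + 18) / 8) (P : Set Plane)ᶜ) ∧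
    covMax n ≤ ((5 * n + 18) / 8 : ℕ) := by
  have hcov (P : Finset Plane) (hn : P.card = n) (hP : InGeneralPosition (P : Set Plane)) :
      CoveredByConvex ((5 * n + 18) / 8) (P : Set Plane)ᶜ :=
    hn ▸ coveredByConvex_compl_five_eighths hP
  exact ⟨hcov, iSup_le fun P => iSup₂_le fun hn hP => (hcov P hn hP).convexityNumber_le⟩

theorem theorem5 (n : ℕ) :
    (∀ P : Finset Plane, P.card = n → InGeneralPosition (P : Set Plane) →
      ∃ k : ℕ, (k : ℝ) ≤ 7 * (n : ℝ) / 11 + 4 ∧ CoveredByConvex k (P : Set Plane)ᶜ) ∧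
    (covMax n : ℝ≥0∞) ≤ 7 * (n : ℝ≥0∞) / 11 + 4 := by
  exact ⟨fun P hn hP => ⟨_, five_mul_add_div_eight_le n, (theorem5_general n).1 P hn hP⟩,
    (ENat.toENNReal_le.2 (theorem5_general n).2).trans (ennreal_five_mul_add_div_eight_le n)⟩
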